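/- **Theorem 3 (Gradient and Hessian in expectation).** Let $\phi(t)=t$ (linear networks, $p=1$) or $\phi(t)=\max\{t,0\}$ (ReLU networks, $p=\tfrac12$). For inputs $x_1,\dots,x_n\in\mathbb R^{d_{in}}$, targets $y_1,\dots,y_n\in\mathbb R^{d_{out}}$, matrices $A\in\mathbb R^{d\times d_{in}}$, $B\in\mathbb R^{d_{out}\times d}$ and weights $W=(W^1,\dots,W^L)$, $W^\ell\in\mathbb R^{d\times d}$, let $$\mathcal L(W)=\frac1{2n}\sum_{i=1}^n\big\|y_i-BD_i^LW^LD_i^{L-1}W^{L-1}\cdots W^1D_i^0Ax_i\big\|_2^2 ,$$ where $D_i^\ell$ is the diagonal matrix of activation gates of layer $\ell$ for the input $x_i$ ($D_i^\ell=I$ for linear networks; for ReLU networks its diagonal entries are $1$ where the preactivation is positive and $0$ elsewhere), so that $\mathcal L$ is the squared loss of the multilayer perceptron with hidden activation $\phi$. Derivatives of $\mathcal L$ at $W$ are taken, as in backpropagation, with the gates held at their values at $W$. Let all entries of all $W^\ell$ be i.i.d. with a law $\mathcal P$ on $\mathbb R$ that is symmetric around $0$ and has variance $\sigma^2<\infty$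 and finite fourth moment. Put $\lambda=pd\sigma^2$, and put $\delta=1$ for linear networks and $\delta=d$ for ReLU networks. Let $R\in\mathbb R$. 1. (Fixed $A$, $B$.) There is a constant $C$ depending only on $R$ such that, whenever $\|B\|_F\le R$ and $\|Ax_i\|_2\le R$, $\|y_i\|_2\le R$ for all $i$, the following expectations are finite and, for all $k\neq\ell$, $$\mathbb E\Big\|\frac{\partial\mathcal L}{\partial W^k}\Big\|_F\le C\sqrt\delta\,\big(\lambda^{\frac{L-1}2}+\lambda^{\frac{2L-1}2}\big),\quad \mathbb E\Big\|\frac{\partial^2\mathcal L}{\partial W^k\partial W^k}\Big\|_F\le C\,\delta\,\lambda^{L-1},\quad \mathbb E\Big\|\frac{\partial^2\mathcal L}{\partial W^k\partial W^\ell}\Big\|_F\le C\sqrt{d\delta}\,\big(\lambda^{\frac{L-2}2}+\lambda^{L-1}\big).$$ In particular the diagonal blocks are at most $C\frac{\delta}{\lambda}\,\lambda^{L}$ if $\lambda>0$, and in the vanishing-stable regime $0<\lambda\le1$ the gradient is at most $C\sqrt{\delta/\lambda}\;\lambda^{L/2}$ and the off-diagonal blocks are at most $C\frac{\sqrt{d\delta}}{\lambda}\,\lambda^{L/2}$,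 in expectation. 2. (Random $A$, $B$.) For every $d_{out}$ there is a constant $C$ depending only on $R$ and $d_{out}$ such that, if the entries of $A$, $B$ and of all $W^\ell$ together are i.i.d. with law $\mathcal P$ and $\|x_i\|_2\le R$, $\|y_i\|_2\le R$ for all $i$, the expectations are finite and, for all $k\ne\ell$, $$\mathbb E\Big\|\frac{\partial\mathcal L}{\partial W^k}\Big\|_F\le C\big(\lambda^{\frac{L+1}2}+\lambda^{\frac{2L+3}2}\big),\quad \mathbb E\Big\|\frac{\partial^2\mathcal L}{\partial W^k\partial W^k}\Big\|_F\le C\lambda^{L+1},\quad \mathbb E\Big\|\frac{\partial^2\mathcal L}{\partial W^k\partial W^\ell}\Big\|_F\le C\big(\sqrt d\,\lambda^{\frac L2}+\lambda^{L+1}\big).$$ In particular, if $\lambda\le1$, these expectations are at most $C\lambda^{L/2}$, $C\lambda^{L}$ and $C\sqrt d\,\lambda^{L/2}$, respectively. 3. For fixed $A$, $B$, if the network is linear or $\mathcal P$ has no atoms, then for almost every $W$ the loss $\mathcal L$ is $C^\infty$ at $W$ and all gradient and Hessian blocks above are the ordinary partial derivatives of $\mathcal L$ at $W$. -/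

import Mathlib

open MeasureTheory ProbabilityTheory
open scoped Matrix

noncomputable section

/-- The two kinds of networks: linear (`φ t = t`) and ReLU (`φ t = max t 0`). -/
inductive Activation where
  | linear
  | relu

namespace Activation

/-- The non-linearity `φ`. -/
def apply : Activation → ℝ → ℝ
  | linear, t => t
  | relu, t => max t 0

/-- The activation gate at preactivation `t`, with the convention that a ReLU unit is off
at `t = 0`. -/
def gate : Activation → ℝ → ℝ
  | linear, _ => 1
  | relu, t => if 0 < t then 1 else 0

/-- `p = 1` for linear networks and `p = 1/2` for ReLU networks. -/
def p : Activation → ℝ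
  | linear => 1
  | relu => 1 / 2

/-- The factor in the constants for fixed input and output matrices: `1` for linear networks
and the width `d` for ReLU networks. -/
def widthFactor : Activation → ℕ → ℝ
  | linear, _ => 1
  | relu, d => d

theorem gate_mul_self (act : Activation) (t : ℝ) : act.gate t * t = act.apply t := by
  cases act with
  | linear => simp [gate, apply]
  | relu =>
    by_cases h : 0 < t
    · simp [gate, apply, h, h.le]
    · simp [gate, apply, h, not_lt.mp h]

end Activation

/-- The weights `W^1, …, W^L` (stored with indices `0, …, L - 1`), each of size `d × d`. -/
abbrev Weights (L d : ℕ) : Type := Fin L → Fin d → Fin d → ℝ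

/-- Euclidean norm of a vector. -/
def euclNorm {ι : Type*} [Fintype ι] (v : ι → ℝ) : ℝ := √(∑ i, v i ^ 2)

/-- Frobenius norm of a matrix. -/
def frobNorm {ι κ : Type*} [Fintype ι] [Fintype κ] (M : Matrix ι κ ℝ) : ℝ :=
  √(∑ i, ∑ j, M i j ^ 2)

section Network

variable {L d dIn dOut n : ℕ}

/-- The preactivation of layer `ℓ` of the network with first preactivation `z`:
`a^0 = z` and `a^{ℓ+1} = W^{ℓ+1} φ(a^ℓ)` for `ℓ < L` (the value for `ℓ > L` is never used). -/
def preact (act : Activation) (W : Weights L d) (z : Fin d → ℝ) : ℕ → Fin d → ℝ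
  | 0 => z
  | ℓ + 1 =>
    if h : ℓ < L then Matrix.of (W ⟨ℓ, h⟩) *ᵥ (fun i => act.apply (preact act W z ℓ i)) else 0

/-- The diagonals of the gate matrices `D^0, …, D^L` at the weights `W`. -/
def gates (act : Activation) (W : Weights L d) (z : Fin d → ℝ) (ℓ : ℕ) (i : Fin d) : ℝ :=
  act.gate (preact act W z ℓ i)

/-- The vector `W^ℓ D^{ℓ-1} W^{ℓ-1} ⋯ W^1 D^0 z` for prescribed gates `D`. -/
def gatedPreact (D : ℕ → Fin d → ℝ) (W : Weights L d) (z : Fin d → ℝ) : ℕ → Fin d → ℝ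
  | 0 => z
  | ℓ + 1 =>
    if h : ℓ < L then Matrix.of (W ⟨ℓ, h⟩) *ᵥ (fun i => D ℓ i * gatedPreact D W z ℓ i) else 0

/-- The loss `1/(2n) ∑ᵢ ‖yᵢ - B φ(a^L(xᵢ))‖²` of the network, as a function of the weights. -/
def loss (act : Activation) (A : Matrix (Fin d) (Fin dIn) ℝ) (B : Matrix (Fin dOut) (Fin d) ℝ)
    (x : Fin n → Fin dIn → ℝ) (y : Fin n → Fin dOut → ℝ) (W : Weights L d) : ℝ :=
  1 / (2 * (n : ℝ)) * ∑ s, euclNorm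
    (y s - B *ᵥ (fun i => act.apply (preact act W (A *ᵥ x s) L i))) ^ 2

/-- The loss `1/(2n) ∑ᵢ ‖yᵢ - B D^L V^L D^{L-1} ⋯ V^1 D^0 A xᵢ‖²` at the weights `V`, where the
gates `D^ℓ` (one family for each sample) are held at their values at the weights `W`. -/
def gatedLoss (act : Activation) (A : Matrix (Fin d) (Fin dIn) ℝ)
    (B : Matrix (Fin dOut) (Fin d) ℝ) (x : Fin n → Fin dIn → ℝ) (y : Fin n → Fin dOut → ℝ)
    (W V : Weights L d) : ℝ :=
  1 / (2 * (n : ℝ)) * ∑ s, euclNorm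
    (y s - B *ᵥ (fun i => gates act W (A *ᵥ x s) L i *
      gatedPreact (gates act W (A *ᵥ x s)) V (A *ᵥ x s) L i)) ^ 2

/-- The gated loss at the point where its gates are computed is the loss. -/
theorem gatedLoss_self (act : Activation) (A : Matrix (Fin d) (Fin dIn) ℝ)
    (B : Matrix (Fin dOut) (Fin d) ℝ) (x : Fin n → Fin dIn → ℝ) (y : Fin n → Fin dOut → ℝ)
    (W : Weights L d) : gatedLoss act A B x y W W = loss act A B x y W := by
  have key : ∀ (z : Fin d → ℝ) (ℓ : ℕ),
      gatedPreact (gates act W z) W z ℓ = preact act W z ℓ := by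
    intro z ℓ
    induction ℓ with
    | zero => rfl
    | succ m ih => simp only [gatedPreact, preact, ih, gates, Activation.gate_mul_self]
  simp only [gatedLoss, loss, key, gates, Activation.gate_mul_self]

/-- The unit perturbation of the entry `(i, j)` of the `k`-th weight matrix. -/
def unitWeight (k : Fin L) (i j : Fin d) : Weights L d :=
  Pi.single k (Pi.single i (Pi.single j 1))

/-- The gradient `∂f/∂W_k`, a `d × d` matrix. -/
def gradBlock (f : Weights L d → ℝ) (W : Weights L d) (k : Fin L) :
    Matrix (Fin d) (Fin d) ℝ :=
  Matrix.of fun i j => fderiv ℝ f W (unitWeight k i j)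

/-- The Hessian block `∂²f/∂W_k∂W_ℓ`, a `d² × d²` matrix. -/
def hessBlock (f : Weights L d → ℝ) (W : Weights L d) (k ℓ : Fin L) :
    Matrix (Fin d × Fin d) (Fin d × Fin d) ℝ :=
  Matrix.of fun a b =>
    fderiv ℝ (fun V => fderiv ℝ f V (unitWeight ℓ b.1 b.2)) W (unitWeight k a.1 a.2)

/-- Frobenius norm of the gradient of the loss with respect to `W_k` at `W`. For ReLU networks the
gates are treated as locally constant, as in backpropagation. -/
def gradNorm (act : Activation) (A : Matrix (Fin d) (Fin dIn) ℝ)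
    (B : Matrix (Fin dOut) (Fin d) ℝ) (x : Fin n → Fin dIn → ℝ) (y : Fin n → Fin dOut → ℝ)
    (W : Weights L d) (k : Fin L) : ℝ :=
  frobNorm (gradBlock (gatedLoss act A B x y W) W k)

/-- Frobenius norm of the block `(k, ℓ)` of the Hessian of the loss at `W`. For ReLU networks the
gates are treated as locally constant, as in backpropagation. -/
def hessNorm (act : Activation) (A : Matrix (Fin d) (Fin dIn) ℝ)
    (B : Matrix (Fin dOut) (Fin d) ℝ) (x : Fin n → Fin dIn → ℝ) (y : Fin n → Fin dOut → ℝ)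
    (W : Weights L d) (k ℓ : Fin L) : ℝ :=
  frobNorm (hessBlock (gatedLoss act A B x y W) W k ℓ)

end Network

/-- A probability distribution on `ℝ` that is symmetric around zero, with variance `σ²` and
finite fourth moment. -/
structure IsInitLaw (P : Measure ℝ) (σ : ℝ) : Prop where
  isProbabilityMeasure : IsProbabilityMeasure P
  symmetric : P.map (fun t => -t) = P
  memLp_four : MemLp id 4 P
  variance_eq : variance id P = σ ^ 2

/-- The law of the weights when all entries of all `W^ℓ` are i.i.d. of law `P`. -/
def initLaw (P : Measure ℝ) (L d : ℕ) : Measure (Weights L d) :=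
  Measure.pi fun _ : Fin L => Measure.pi fun _ : Fin d => Measure.pi fun _ : Fin d => P

/-- The joint law of the entries of `(A, B, (W^ℓ)_ℓ)` when all of them are i.i.d. of law `P`. -/
def jointLaw (P : Measure ℝ) (dIn dOut d L : ℕ) :
    Measure ((Fin d → Fin dIn → ℝ) × (Fin dOut → Fin d → ℝ) × Weights L d) :=
  (Measure.pi fun _ : Fin d => Measure.pi fun _ : Fin dIn => P).prod
    ((Measure.pi fun _ : Fin dOut => Measure.pi fun _ : Fin d => P).prod (initLaw P L d))

/-- `lam = p d σ²`. -/
def lam (act : Activation) (d : ℕ) (σ : ℝ) : ℝ := act.p * d * σ ^ 2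

end

/-!
With its gates held fixed, the network is affine in each weight matrix separately, so the gradient
and the Hessian blocks of the loss are averages over the samples of products of norms of the
output and of its first and second derivatives, and by Cauchy–Schwarz second moments suffice. These
are computed one layer at a time, from the last layer down, conditioning on the layers below.
Resampling the sign of a row of a weight matrix shows that, in mean square, its ReLU gate keeps
exactly the fraction `p` of the preactivation, so each layer multiplies a second moment by at most
`lam`; only a fixed output matrix behind the last ReLU gates costs the factor `d`, whereas a random
output matrix averages them out.

If the law of the weights has no atoms, then almost surely a preactivation vanishes only when the
whole layer below is switched off. Near such weights every gate is constant or multiplies a layer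
which stays zero, so the loss agrees with its gated version in a neighbourhood.
-/

open scoped ENNReal Topology

section Norms

variable {ι κ τ : Type*} [Fintype ι] [Fintype κ] [Fintype τ]

theorem euclNorm_nonneg (v : ι → ℝ) : 0 ≤ euclNorm v := Real.sqrt_nonneg _

theorem frobNorm_nonneg (M : Matrix ι κ ℝ) : 0 ≤ frobNorm M := Real.sqrt_nonneg _

theorem euclNorm_sq (v : ι → ℝ) : euclNorm v ^ 2 = ∑ i, v i ^ 2 :=
  Real.sq_sqrt (by positivity)

theorem frobNorm_sq (M : Matrix ι κ ℝ) : frobNorm M ^ 2 = ∑ i, ∑ j, M i j ^ 2 :=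
  Real.sq_sqrt (by positivity)

theorem frobNorm_sq_eq_sum_row (M : Matrix ι κ ℝ) :
    frobNorm M ^ 2 = ∑ i, euclNorm (M i) ^ 2 := by
  simp only [frobNorm_sq, euclNorm_sq]

theorem frobNorm_transpose (M : Matrix ι κ ℝ) : frobNorm Mᵀ = frobNorm M :=
  congrArg Real.sqrt Finset.sum_comm

theorem frobNorm_sq_eq_sum_col (M : Matrix ι κ ℝ) :
    frobNorm M ^ 2 = ∑ j, euclNorm (M.col j) ^ 2 := by
  rw [← frobNorm_transpose, frobNorm_sq_eq_sum_row]
  rfl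

theorem frobNorm_eq_euclNorm (M : Matrix ι κ ℝ) :
    frobNorm M = euclNorm fun a : ι × κ => M a.1 a.2 := by
  simp only [frobNorm, euclNorm, Fintype.sum_prod_type]

theorem euclNorm_eq_norm (v : ι → ℝ) : euclNorm v = ‖WithLp.toLp 2 v‖ := by
  simp [euclNorm, EuclideanSpace.norm_eq]

theorem euclNorm_sub_le (v w : ι → ℝ) : euclNorm (v - w) ≤ euclNorm v + euclNorm w := by
  simp only [euclNorm_eq_norm, WithLp.toLp_sub]
  exact norm_sub_le _ _

open scoped Matrix.Norms.Frobenius in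
theorem frobNorm_eq_norm (M : Matrix ι κ ℝ) : frobNorm M = ‖M‖ := by
  simp [frobNorm, Matrix.frobenius_norm_def, Real.sqrt_eq_rpow]

open scoped Matrix.Norms.Frobenius in
theorem frobNorm_add_le (M N : Matrix ι κ ℝ) : frobNorm (M + N) ≤ frobNorm M + frobNorm N := by
  simpa only [frobNorm_eq_norm] using norm_add_le M N

open scoped Matrix.Norms.Frobenius in
theorem frobNorm_mul_le (M : Matrix ι κ ℝ) (N : Matrix κ τ ℝ) :
    frobNorm (M * N) ≤ frobNorm M * frobNorm N := by
  simpa only [frobNorm_eq_norm] using Matrix.frobenius_norm_mul M N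

open scoped Matrix.Norms.Frobenius in
theorem frobNorm_mean_le {n : ℕ} (M : Fin n → Matrix ι κ ℝ) :
    frobNorm ((1 / (n : ℝ)) • ∑ s, M s) ≤ 1 / (n : ℝ) * ∑ s, frobNorm (M s) := by
  simp only [frobNorm_eq_norm]
  rw [norm_smul, Real.norm_of_nonneg (by positivity)]
  gcongr
  exact norm_sum_le _ _

theorem frobNorm_replicateCol (v : ι → ℝ) : frobNorm (Matrix.replicateCol Unit v) = euclNorm v := by
  simp [frobNorm, euclNorm]

theorem euclNorm_mulVec_le (M : Matrix ι κ ℝ) (v : κ → ℝ) :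
    euclNorm (M *ᵥ v) ≤ frobNorm M * euclNorm v := by
  rw [← frobNorm_replicateCol, ← frobNorm_replicateCol, Matrix.replicateCol_mulVec]
  exact frobNorm_mul_le _ _

theorem frobNorm_of_mulVec_sub_le (M : Matrix (ι × κ) τ ℝ) (v w : τ → ℝ) :
    frobNorm (Matrix.of fun i j => (M *ᵥ (v - w)) (i, j)) ≤
      (euclNorm v + euclNorm w) * frobNorm M := by
  rw [frobNorm_eq_euclNorm, mul_comm]
  exact (euclNorm_mulVec_le M (v - w)).trans
    (mul_le_mul_of_nonneg_left (euclNorm_sub_le v w) (frobNorm_nonneg M))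

end Norms

section Chain

variable {L d : ℕ}

/-- The weight matrix of layer `b`, zero if there is no such layer. -/
def layer (V : Weights L d) (b : ℕ) : Matrix (Fin d) (Fin d) ℝ :=
  if h : b < L then Matrix.of (V ⟨b, h⟩) else 0

/-- The product `D^b V_{b-1} D^{b-1} ⋯ V_a D^a` of the layers `a, …, b - 1` and of the gates around
them, set to `D^b` if `b ≤ a`. -/
noncomputable def chain (D : ℕ → Fin d → ℝ) (V : Weights L d) (a : ℕ) :
    ℕ → Matrix (Fin d) (Fin d) ℝ
  | 0 => Matrix.diagonal (D 0)
  | b + 1 =>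
    if a ≤ b then Matrix.diagonal (D (b + 1)) * (layer V b * chain D V a b)
    else Matrix.diagonal (D (b + 1))

theorem chain_self (D : ℕ → Fin d → ℝ) (V : Weights L d) (a : ℕ) :
    chain D V a a = Matrix.diagonal (D a) := by
  cases a <;> simp [chain]

theorem chain_succ (D : ℕ → Fin d → ℝ) (V : Weights L d) {a b : ℕ} (h : a ≤ b) :
    chain D V a (b + 1) = Matrix.diagonal (D (b + 1)) * (layer V b * chain D V a b) := by
  simp [chain, h]

theorem chain_zero_mulVec (D : ℕ → Fin d → ℝ) (V : Weights L d) (z : Fin d → ℝ) (b : ℕ) :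
    chain D V 0 b *ᵥ z = fun i => D b i * gatedPreact D V z b i := by
  induction b with
  | zero => ext i; simp [chain, gatedPreact, Matrix.mulVec_diagonal]
  | succ b ih =>
    ext i
    rw [chain_succ D V b.zero_le, ← Matrix.mulVec_mulVec, ← Matrix.mulVec_mulVec, ih,
      Matrix.mulVec_diagonal]
    by_cases h : b < L <;> simp [gatedPreact, layer, h]

theorem chain_split (D : ℕ → Fin d → ℝ) (V : Weights L d) {a k b : ℕ} (hak : a ≤ k) (hkb : k < b) :
    chain D V a b = chain D V (k + 1) b * layer V k * chain D V a k := by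
  induction b, hkb using Nat.le_induction with
  | base => rw [chain_succ D V hak, chain_self, Matrix.mul_assoc]
  | succ b hb ih =>
    have hkb : k < b := hb
    rw [chain_succ D V (hak.trans hkb.le), chain_succ D V hkb, ih]
    simp only [Matrix.mul_assoc]

theorem chain_congr (D : ℕ → Fin d → ℝ) {V V' : Weights L d} {a b : ℕ}
    (h : ∀ j, a ≤ j → j < b → layer V j = layer V' j) : chain D V a b = chain D V' a b := by
  induction b with
  | zero => rfl
  | succ b ih =>
    by_cases hab : a ≤ b
    · rw [chain_succ _ _ hab, chain_succ _ _ hab, h b hab b.lt_succ_self,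
        ih fun j haj hjb => h j haj (hjb.trans b.lt_succ_self)]
    · simp [chain, hab]

theorem layer_add_smul_self (V : Weights L d) (k : Fin L) (i j : Fin d) (t : ℝ) :
    layer (V + t • unitWeight k i j) k = layer V k + t • Matrix.single i j 1 := by
  ext p q
  simp [layer, unitWeight, Matrix.single_apply, Pi.single_apply, ite_apply, eq_comm, ite_and]

theorem layer_add_smul_of_ne (V : Weights L d) (k : Fin L) (i j : Fin d) (t : ℝ) {b : ℕ}
    (h : b ≠ k) : layer (V + t • unitWeight k i j) b = layer V b := by
  by_cases hb : b < L
  · have hk : (⟨b, hb⟩ : Fin L) ≠ k := fun e => h (congrArg Fin.val e)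
    ext p q
    simp [layer, unitWeight, hb, hk]
  · simp [layer, hb]

theorem chain_add_smul_of_notMem (D : ℕ → Fin d → ℝ) (V : Weights L d) (k : Fin L) (i j : Fin d)
    (t : ℝ) {a b : ℕ} (h : (k : ℕ) ∉ Set.Ico a b) :
    chain D (V + t • unitWeight k i j) a b = chain D V a b :=
  chain_congr D fun _ ham hmb => layer_add_smul_of_ne V k i j t fun e => h (e ▸ ⟨ham, hmb⟩)

theorem chain_add_smul (D : ℕ → Fin d → ℝ) (V : Weights L d) (k : Fin L) (i j : Fin d)
    (t : ℝ) {a b : ℕ} (hak : a ≤ k) (hkb : (k : ℕ) < b) :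
    chain D (V + t • unitWeight k i j) a b =
      chain D V a b + t • (chain D V (k + 1) b * Matrix.single i j 1 * chain D V a k) := by
  rw [chain_split D _ hak hkb, chain_split D V hak hkb, layer_add_smul_self,
    chain_add_smul_of_notMem D V k i j t (by simp), chain_add_smul_of_notMem D V k i j t (by simp),
    Matrix.mul_add, Matrix.add_mul, Matrix.mul_smul, Matrix.smul_mul]

theorem contDiff_layer_apply (b : ℕ) (i j : Fin d) :
    ContDiff ℝ (⊤ : ℕ∞) fun V : Weights L d => layer V b i j := by
  by_cases hb : b < L
  · simp only [layer, hb, dite_true, Matrix.of_apply]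
    fun_prop
  · simp only [layer, hb, dite_false]
    exact contDiff_const

theorem contDiff_chain_apply (D : ℕ → Fin d → ℝ) (a b : ℕ) (i j : Fin d) :
    ContDiff ℝ (⊤ : ℕ∞) fun V : Weights L d => chain D V a b i j := by
  induction b generalizing i j with
  | zero => exact contDiff_const
  | succ b ih =>
    by_cases hab : a ≤ b
    · simp only [chain, if_pos hab, Matrix.diagonal_mul]
      simp only [Matrix.mul_apply]
      exact contDiff_const.mul (ContDiff.sum fun k _ => (contDiff_layer_apply b i k).mul (ih k j))
    · simp only [chain, if_neg hab]
      exact contDiff_const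

end Chain

section Derivatives

variable {L d dOut n : ℕ}

/-- The output `B D^L V_{L-1} ⋯ V_0 D^0 z` of the network with gates `D`. -/
noncomputable def netOut (B : Matrix (Fin dOut) (Fin d) ℝ) (D : ℕ → Fin d → ℝ) (z : Fin d → ℝ)
    (V : Weights L d) : Fin dOut → ℝ :=
  B *ᵥ (chain D V 0 L *ᵥ z)

/-- The transposed Jacobian of the output with respect to the `k`-th weight matrix: the row with
index `(i, j)` is the derivative of the output in the direction of the entry `(i, j)`. -/
noncomputable def jac (B : Matrix (Fin dOut) (Fin d) ℝ) (D : ℕ → Fin d → ℝ) (z : Fin d → ℝ)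
    (V : Weights L d) (k : ℕ) : Matrix (Fin d × Fin d) (Fin dOut) ℝ :=
  Matrix.of fun a o => (B * chain D V (k + 1) L) o a.1 * (chain D V 0 k *ᵥ z) a.2

/-- The second derivatives of the output with respect to the `k`-th and the `l`-th weight matrix,
for `k < l`: the row with index `(a, b)` is the second derivative in the directions of the entries
`a` of the `k`-th and `b` of the `l`-th weight matrix. -/
noncomputable def jac₂ (B : Matrix (Fin dOut) (Fin d) ℝ) (D : ℕ → Fin d → ℝ) (z : Fin d → ℝ)
    (V : Weights L d) (k l : ℕ) : Matrix ((Fin d × Fin d) × Fin d × Fin d) (Fin dOut) ℝ :=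
  Matrix.of fun ab o => (B * chain D V (l + 1) L) o ab.2.1 *
    (chain D V (k + 1) l ab.2.2 ab.1.1 * (chain D V 0 k *ᵥ z) ab.1.2)

theorem frobNorm_jac (B : Matrix (Fin dOut) (Fin d) ℝ) (D : ℕ → Fin d → ℝ) (z : Fin d → ℝ)
    (V : Weights L d) (k : ℕ) :
    frobNorm (jac B D z V k) =
      frobNorm (B * chain D V (k + 1) L) * euclNorm (chain D V 0 k *ᵥ z) := by
  rw [← sq_eq_sq₀ (frobNorm_nonneg _) (mul_nonneg (frobNorm_nonneg _) (euclNorm_nonneg _)),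
    mul_pow, ← frobNorm_transpose, frobNorm_sq, frobNorm_sq, euclNorm_sq]
  simp only [jac, Matrix.transpose_apply, Matrix.of_apply, mul_pow, Fintype.sum_prod_type,
    ← Finset.mul_sum, ← Finset.sum_mul]

theorem frobNorm_jac₂ (B : Matrix (Fin dOut) (Fin d) ℝ) (D : ℕ → Fin d → ℝ) (z : Fin d → ℝ)
    (V : Weights L d) (k l : ℕ) :
    frobNorm (jac₂ B D z V k l) = frobNorm (B * chain D V (l + 1) L) *
      (frobNorm (chain D V (k + 1) l) * euclNorm (chain D V 0 k *ᵥ z)) := by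
  rw [← sq_eq_sq₀ (frobNorm_nonneg _) (mul_nonneg (frobNorm_nonneg _)
    (mul_nonneg (frobNorm_nonneg _) (euclNorm_nonneg _))), mul_pow, mul_pow,
    ← frobNorm_transpose (chain D V (k + 1) l), frobNorm_sq, frobNorm_sq_eq_sum_col, frobNorm_sq,
    euclNorm_sq]
  simp only [jac₂, Matrix.transpose_apply, Matrix.of_apply, mul_pow, Fintype.sum_prod_type,
    euclNorm_sq, Matrix.col_apply, ← Finset.mul_sum, ← Finset.sum_mul]

theorem mul_single_mul_mulVec {ι κ τ υ : Type*} [Fintype κ] [DecidableEq κ] [Fintype τ]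
    [DecidableEq τ] [Fintype υ] (M : Matrix ι κ ℝ) (N : Matrix τ υ ℝ) (i : κ) (j : τ)
    (z : υ → ℝ) :
    (M * Matrix.single i j (1 : ℝ) * N) *ᵥ z = (N *ᵥ z) j • M.col i := by
  rw [← Matrix.mulVec_mulVec, ← Matrix.mulVec_mulVec, Matrix.single_mulVec]
  ext p
  simp [Matrix.mulVec, dotProduct, Function.update_apply, mul_comm]

theorem netOut_add_smul (B : Matrix (Fin dOut) (Fin d) ℝ) (D : ℕ → Fin d → ℝ) (z : Fin d → ℝ)
    (V : Weights L d) (k : Fin L) (i j : Fin d) (t : ℝ) :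
    netOut B D z (V + t • unitWeight k i j) = netOut B D z V + t • jac B D z V k (i, j) := by
  unfold netOut
  rw [chain_add_smul D V k i j t (Nat.zero_le _) k.2, Matrix.add_mulVec, Matrix.mulVec_add,
    Matrix.smul_mulVec, Matrix.mulVec_smul, Matrix.mulVec_mulVec (M := B) (N := _ * _ * _),
    ← Matrix.mul_assoc, ← Matrix.mul_assoc, mul_single_mul_mulVec]
  congr 2
  ext o
  simp [jac, mul_comm]

theorem jac_add_smul_self (B : Matrix (Fin dOut) (Fin d) ℝ) (D : ℕ → Fin d → ℝ)
    (z : Fin d → ℝ) (V : Weights L d) (k : Fin L) (i j : Fin d) (t : ℝ) :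
    jac B D z (V + t • unitWeight k i j) k = jac B D z V k := by
  unfold jac
  rw [chain_add_smul_of_notMem D V k i j t (by simp),
    chain_add_smul_of_notMem D V k i j t (by simp)]

theorem jac_add_smul_of_lt (B : Matrix (Fin dOut) (Fin d) ℝ) (D : ℕ → Fin d → ℝ)
    (z : Fin d → ℝ) (V : Weights L d) {k l : Fin L} (h : k < l) (i j : Fin d)
    (b : Fin d × Fin d) (t : ℝ) :
    jac B D z (V + t • unitWeight k i j) l b =
      jac B D z V l b + t • jac₂ B D z V k l ((i, j), b) := by
  have hkl : (k : ℕ) < l := h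
  ext o
  simp only [jac, jac₂, Matrix.of_apply, Pi.add_apply, Pi.smul_apply, smul_eq_mul]
  rw [chain_add_smul_of_notMem D V k i j t (a := l + 1) (fun hk => by have := hk.1; omega),
    chain_add_smul D V k i j t (Nat.zero_le _) hkl, Matrix.add_mulVec, Matrix.smul_mulVec,
    mul_single_mul_mulVec]
  simp only [Pi.add_apply, Pi.smul_apply, smul_eq_mul, Matrix.col_apply]
  ring

theorem contDiff_netOut (B : Matrix (Fin dOut) (Fin d) ℝ) (D : ℕ → Fin d → ℝ) (z : Fin d → ℝ) :
    ContDiff ℝ (⊤ : ℕ∞) (netOut (L := L) B D z) := by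
  have := contDiff_chain_apply (L := L) D 0 L
  refine contDiff_pi.mpr fun o => ?_
  simp only [netOut, Matrix.mulVec, dotProduct]
  fun_prop

theorem contDiff_jac (B : Matrix (Fin dOut) (Fin d) ℝ) (D : ℕ → Fin d → ℝ) (z : Fin d → ℝ)
    (k : ℕ) (a : Fin d × Fin d) :
    ContDiff ℝ (⊤ : ℕ∞) fun V : Weights L d => jac B D z V k a := by
  have hin := contDiff_chain_apply (L := L) D 0 k
  have hout := contDiff_chain_apply (L := L) D (k + 1) L
  refine contDiff_pi.mpr fun o => ?_
  simp only [jac, Matrix.of_apply, Matrix.mul_apply, Matrix.mulVec, dotProduct]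
  fun_prop

/-- The quadratic loss of the networks with gates `D s` and first preactivations `z s`. -/
noncomputable def chainLoss (B : Matrix (Fin dOut) (Fin d) ℝ) (D : Fin n → ℕ → Fin d → ℝ)
    (z : Fin n → Fin d → ℝ) (y : Fin n → Fin dOut → ℝ) (V : Weights L d) : ℝ :=
  1 / (2 * (n : ℝ)) * ∑ s, euclNorm (y s - netOut B (D s) (z s) V) ^ 2

theorem gatedLoss_eq_chainLoss {dIn : ℕ} (act : Activation) (A : Matrix (Fin d) (Fin dIn) ℝ)
    (B : Matrix (Fin dOut) (Fin d) ℝ) (x : Fin n → Fin dIn → ℝ) (y : Fin n → Fin dOut → ℝ)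
    (W : Weights L d) :
    gatedLoss act A B x y W =
      chainLoss B (fun s => gates act W (A *ᵥ x s)) (fun s => A *ᵥ x s) y := by
  ext V
  simp only [gatedLoss, chainLoss, netOut, chain_zero_mulVec]

theorem contDiff_chainLoss (B : Matrix (Fin dOut) (Fin d) ℝ) (D : Fin n → ℕ → Fin d → ℝ)
    (z : Fin n → Fin d → ℝ) (y : Fin n → Fin dOut → ℝ) :
    ContDiff ℝ (⊤ : ℕ∞) (chainLoss (L := L) B D z y) := by
  have := fun s => contDiff_pi.mp (contDiff_netOut (L := L) B (D s) (z s))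
  unfold chainLoss
  simp only [euclNorm_sq, Pi.sub_apply]
  fun_prop

theorem fderiv_apply_eq_of_hasDerivAt {E : Type*} [NormedAddCommGroup E] [NormedSpace ℝ E]
    {f : E → ℝ} {V v : E} {c : ℝ} (hf : DifferentiableAt ℝ f V)
    (h : HasDerivAt (fun t : ℝ => f (V + t • v)) c 0) : fderiv ℝ f V v = c :=
  (hf.hasFDerivAt.hasLineDerivAt v).unique h

theorem hasDerivAt_add_smul_dotProduct {ι : Type*} [Fintype ι] (u u' v v' : ι → ℝ) :
    HasDerivAt (fun t : ℝ => (u + t • u') ⬝ᵥ (v + t • v')) (u ⬝ᵥ v' + u' ⬝ᵥ v) 0 := by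
  have haff (a b : ℝ) : HasDerivAt (fun t : ℝ => a + t * b) b 0 := by
    simpa using ((hasDerivAt_id (0 : ℝ)).mul_const b).const_add a
  refine (HasDerivAt.fun_sum fun i (_ : i ∈ Finset.univ) =>
    (haff (u i) (u' i)).mul (haff (v i) (v' i))).congr_deriv ?_
  simp only [zero_mul, add_zero, dotProduct, ← Finset.sum_add_distrib, add_comm]

theorem fderiv_chainLoss (B : Matrix (Fin dOut) (Fin d) ℝ) (D : Fin n → ℕ → Fin d → ℝ)
    (z : Fin n → Fin d → ℝ) (y : Fin n → Fin dOut → ℝ) (V : Weights L d) (k : Fin L)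
    (i j : Fin d) :
    fderiv ℝ (chainLoss B D z y) V (unitWeight k i j) =
      1 / (n : ℝ) * ∑ s, jac B (D s) (z s) V k (i, j) ⬝ᵥ (netOut B (D s) (z s) V - y s) := by
  refine fderiv_apply_eq_of_hasDerivAt
    ((contDiff_chainLoss B D z y).differentiable (by simp)).differentiableAt ?_
  have hloss (t : ℝ) : chainLoss B D z y (V + t • unitWeight k i j) = 1 / (2 * (n : ℝ)) *
      ∑ s, (netOut B (D s) (z s) V - y s + t • jac B (D s) (z s) V k (i, j)) ⬝ᵥ
        (netOut B (D s) (z s) V - y s + t • jac B (D s) (z s) V k (i, j)) := by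
    simp only [chainLoss, netOut_add_smul, euclNorm_sq, dotProduct, Pi.sub_apply, Pi.add_apply,
      Pi.smul_apply]
    congr! 4
    ring
  simp only [hloss]
  refine ((HasDerivAt.fun_sum fun s (_ : s ∈ Finset.univ) =>
    hasDerivAt_add_smul_dotProduct _ _ _ _).const_mul _).congr_deriv ?_
  simp only [dotProduct_comm (netOut B (D _) (z _) V - y _), ← two_mul, ← Finset.mul_sum]
  rw [← mul_assoc, one_div_mul_eq_div, div_mul_cancel_left₀ two_ne_zero, one_div]

theorem fderiv_fderiv_chainLoss (B : Matrix (Fin dOut) (Fin d) ℝ) (D : Fin n → ℕ → Fin d → ℝ)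
    (z : Fin n → Fin d → ℝ) (y : Fin n → Fin dOut → ℝ) (W : Weights L d) (k l : Fin L)
    (a b : Fin d × Fin d) (c : Fin n → Fin dOut → ℝ)
    (hc : ∀ s (t : ℝ), jac B (D s) (z s) (W + t • unitWeight k a.1 a.2) l b =
      jac B (D s) (z s) W l b + t • c s) :
    fderiv ℝ (fun V => fderiv ℝ (chainLoss B D z y) V (unitWeight l b.1 b.2)) W
        (unitWeight k a.1 a.2) =
      1 / (n : ℝ) * ∑ s, (jac B (D s) (z s) W l b ⬝ᵥ jac B (D s) (z s) W k a +
        c s ⬝ᵥ (netOut B (D s) (z s) W - y s)) := by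
  simp only [fderiv_chainLoss]
  refine fderiv_apply_eq_of_hasDerivAt ?_ ?_
  · have hout := fun s => contDiff_pi.mp (contDiff_netOut (L := L) B (D s) (z s))
    have hjac := fun s => contDiff_pi.mp (contDiff_jac (L := L) B (D s) (z s) l b)
    refine ContDiff.differentiable (n := (⊤ : ℕ∞)) ?_ (by simp) |>.differentiableAt
    simp only [dotProduct, Pi.sub_apply]
    fun_prop
  simp only [hc, netOut_add_smul, add_sub_right_comm]
  exact (HasDerivAt.fun_sum fun s _ => hasDerivAt_add_smul_dotProduct _ _ _ _).const_mul _

end Derivatives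

section Blocks

variable {L d dIn dOut n : ℕ} (act : Activation) (A : Matrix (Fin d) (Fin dIn) ℝ)
  (B : Matrix (Fin dOut) (Fin d) ℝ) (x : Fin n → Fin dIn → ℝ) (y : Fin n → Fin dOut → ℝ)
  (W : Weights L d)

theorem contDiff_gatedLoss : ContDiff ℝ (⊤ : ℕ∞) (gatedLoss act A B x y W) := by
  rw [gatedLoss_eq_chainLoss]
  exact contDiff_chainLoss _ _ _ _

theorem gradBlock_gatedLoss (k : Fin L) :
    gradBlock (gatedLoss act A B x y W) W k = (1 / (n : ℝ)) • ∑ s, Matrix.of fun i j =>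
      (jac B (gates act W (A *ᵥ x s)) (A *ᵥ x s) W k *ᵥ
        (netOut B (gates act W (A *ᵥ x s)) (A *ᵥ x s) W - y s)) (i, j) := by
  ext i j
  simp only [gradBlock, gatedLoss_eq_chainLoss, fderiv_chainLoss, Matrix.of_apply,
    Matrix.smul_apply, Matrix.sum_apply, smul_eq_mul, Matrix.mulVec]

theorem hessBlock_gatedLoss_self (k : Fin L) :
    hessBlock (gatedLoss act A B x y W) W k k = (1 / (n : ℝ)) • ∑ s,
      jac B (gates act W (A *ᵥ x s)) (A *ᵥ x s) W k *
        (jac B (gates act W (A *ᵥ x s)) (A *ᵥ x s) W k)ᵀ := by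
  ext a b
  simp only [hessBlock, Matrix.of_apply, gatedLoss_eq_chainLoss, Matrix.smul_apply,
    Matrix.sum_apply, smul_eq_mul]
  rw [fderiv_fderiv_chainLoss (c := 0) (hc := fun s t => by simp [jac_add_smul_self])]
  simp [Matrix.mul_apply, dotProduct, mul_comm]

theorem hessBlock_gatedLoss_of_lt {k l : Fin L} (hkl : k < l) :
    hessBlock (gatedLoss act A B x y W) W k l = (1 / (n : ℝ)) • ∑ s,
      (jac B (gates act W (A *ᵥ x s)) (A *ᵥ x s) W k *
        (jac B (gates act W (A *ᵥ x s)) (A *ᵥ x s) W l)ᵀ +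
      Matrix.of fun a b => (jac₂ B (gates act W (A *ᵥ x s)) (A *ᵥ x s) W k l *ᵥ
        (netOut B (gates act W (A *ᵥ x s)) (A *ᵥ x s) W - y s)) (a, b)) := by
  ext a b
  simp only [hessBlock, Matrix.of_apply, gatedLoss_eq_chainLoss, Matrix.add_apply,
    Matrix.smul_apply, Matrix.sum_apply, smul_eq_mul]
  rw [fderiv_fderiv_chainLoss _ _ _ _ _ _ _ _ _ _
    fun s t => jac_add_smul_of_lt _ _ _ _ hkl _ _ _ _]
  simp [Matrix.mul_apply, Matrix.mulVec, dotProduct, mul_comm]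

theorem gradNorm_le (k : Fin L) :
    gradNorm act A B x y W k ≤ 1 / (n : ℝ) * ∑ s,
      (euclNorm (netOut B (gates act W (A *ᵥ x s)) (A *ᵥ x s) W) + euclNorm (y s)) *
        frobNorm (jac B (gates act W (A *ᵥ x s)) (A *ᵥ x s) W k) := by
  rw [gradNorm, gradBlock_gatedLoss]
  refine (frobNorm_mean_le _).trans ?_
  gcongr with s
  exact frobNorm_of_mulVec_sub_le _ _ _

theorem hessNorm_self_le (k : Fin L) :
    hessNorm act A B x y W k k ≤ 1 / (n : ℝ) * ∑ s,
      frobNorm (jac B (gates act W (A *ᵥ x s)) (A *ᵥ x s) W k) *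
        frobNorm (jac B (gates act W (A *ᵥ x s)) (A *ᵥ x s) W k) := by
  rw [hessNorm, hessBlock_gatedLoss_self]
  refine (frobNorm_mean_le _).trans ?_
  gcongr with s
  exact (frobNorm_mul_le _ _).trans_eq (by rw [frobNorm_transpose])

theorem hessNorm_le_of_lt {k l : Fin L} (hkl : k < l) :
    hessNorm act A B x y W k l ≤ 1 / (n : ℝ) * ∑ s,
      (frobNorm (jac B (gates act W (A *ᵥ x s)) (A *ᵥ x s) W k) *
          frobNorm (jac B (gates act W (A *ᵥ x s)) (A *ᵥ x s) W l) +
        (euclNorm (netOut B (gates act W (A *ᵥ x s)) (A *ᵥ x s) W) + euclNorm (y s)) *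
          frobNorm (jac₂ B (gates act W (A *ᵥ x s)) (A *ᵥ x s) W k l)) := by
  rw [hessNorm, hessBlock_gatedLoss_of_lt _ _ _ _ _ _ hkl]
  refine (frobNorm_mean_le _).trans ?_
  gcongr with s
  exact (frobNorm_add_le _ _).trans (add_le_add
    ((frobNorm_mul_le _ _).trans_eq (by rw [frobNorm_transpose]))
    (frobNorm_of_mulVec_sub_le _ _ _))

theorem hessBlock_transpose {f : Weights L d → ℝ} (hf : ContDiff ℝ 2 f) (k l : Fin L) :
    (hessBlock f W k l)ᵀ = hessBlock f W l k := by
  have hsnd (u v : Weights L d) :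
      fderiv ℝ (fun V => fderiv ℝ f V u) W v = fderiv ℝ (fderiv ℝ f) W v u := by
    rw [fderiv_clm_apply ((hf.fderiv_right (m := 1) le_rfl).differentiable one_ne_zero W)
      (differentiableAt_const u)]
    simp
  ext a b
  simp only [hessBlock, Matrix.transpose_apply, Matrix.of_apply, hsnd]
  exact hf.contDiffAt.isSymmSndFDerivAt (by simp) _ _

theorem hessNorm_comm (k l : Fin L) : hessNorm act A B x y W k l = hessNorm act A B x y W l k := by
  have hsmooth : ContDiff ℝ 2 (gatedLoss act A B x y W) :=
    (contDiff_gatedLoss act A B x y W).of_le (WithTop.coe_le_coe.mpr (le_top : (2 : ℕ∞) ≤ ⊤))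
  rw [hessNorm, hessNorm, ← hessBlock_transpose W hsmooth, frobNorm_transpose]

end Blocks

section Resampling

variable {ι : Type*} [Fintype ι] [DecidableEq ι] {X : ι → Type*} [∀ i, MeasurableSpace (X i)]
  (μ : ∀ i, Measure (X i)) [∀ i, IsProbabilityMeasure (μ i)]

theorem lintegral_pi_update {f : (∀ i, X i) → ℝ≥0∞} (hf : Measurable f) (k : ι) :
    ∫⁻ x, f x ∂Measure.pi μ =
      ∫⁻ x, ∫⁻ w, f (Function.update x k w) ∂μ k ∂Measure.pi μ := by
  obtain ⟨x₀⟩ : Nonempty (∀ i, X i) := (Measure.pi μ).nonempty_of_neZero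
  have hG : Measurable fun x => ∫⁻ w, f (Function.update x k w) ∂μ k :=
    Measurable.lintegral_prod_right'
      (f := fun p : (∀ i, X i) × X k => f (Function.update p.1 k p.2)) (hf.comp measurable_update')
  rw [lintegral_eq_lmarginal_univ x₀, lintegral_eq_lmarginal_univ x₀,
    lmarginal_erase' f hf (Finset.mem_univ k), lmarginal_erase' _ hG (Finset.mem_univ k)]
  simp

theorem lintegral_mul_le_of_update {g F H : (∀ i, X i) → ℝ≥0∞} {K : ℝ≥0∞} {k : ι}
    (hg : Measurable g) (hF : Measurable F) (hH : Measurable H)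
    (hgk : ∀ x w, g (Function.update x k w) = g x)
    (hFH : ∀ x, ∫⁻ w, F (Function.update x k w) ∂μ k ≤ K * H x) :
    ∫⁻ x, g x * F x ∂Measure.pi μ ≤ K * ∫⁻ x, g x * H x ∂Measure.pi μ := by
  have hgF : Measurable fun x => g x * F x := hg.mul hF
  have hgH : Measurable fun x => g x * H x := hg.mul hH
  rw [lintegral_pi_update μ hgF k, ← lintegral_const_mul K hgH]
  refine lintegral_mono fun x => ?_
  have hFx : Measurable fun w => F (Function.update x k w) := hF.comp (measurable_update x)
  simp only [hgk]
  rw [lintegral_const_mul _ hFx, mul_left_comm]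
  exact mul_le_mul_right (hFH x) _

theorem ae_pi_of_forall_ae_update {p : (∀ i, X i) → Prop} (hp : MeasurableSet {x | p x}) (k : ι)
    (h : ∀ x, ∀ᵐ w ∂μ k, p (Function.update x k w)) : ∀ᵐ x ∂Measure.pi μ, p x := by
  have hind : Measurable ({x | p x}ᶜ.indicator fun _ => (1 : ℝ≥0∞)) :=
    measurable_const.indicator hp.compl
  rw [ae_iff, ← Set.compl_ofPred, ← lintegral_indicator_one hp.compl]
  refine (lintegral_pi_update μ hind k).trans ?_
  rw [lintegral_eq_zero_of_ae_eq_zero]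
  refine ae_of_all _ fun x => lintegral_eq_zero_of_ae_eq_zero ?_
  filter_upwards [h x] with w hw
  simpa using hw

end Resampling

section Moments

theorem lintegral_ofReal_sq_eq_variance {Ω : Type*} [MeasurableSpace Ω] {μ : Measure Ω}
    {X : Ω → ℝ} (hX : MemLp X 2 μ) (h0 : ∫ ω, X ω ∂μ = 0) :
    ∫⁻ ω, ENNReal.ofReal (X ω ^ 2) ∂μ = ENNReal.ofReal (variance X μ) := by
  rw [variance_of_integral_eq_zero hX.aestronglyMeasurable.aemeasurable h0,
    ofReal_integral_eq_lintegral_ofReal hX.integrable_sq (ae_of_all _ fun _ => sq_nonneg _)]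

variable {ι : Type*} [Fintype ι] {Ω : ι → Type*} [∀ i, MeasurableSpace (Ω i)]
  {μ : ∀ i, Measure (Ω i)} [∀ i, IsProbabilityMeasure (μ i)] {X : ∀ i, Ω i → ℝ}

theorem memLp_pi_sum (hX : ∀ i, MemLp (X i) 2 (μ i)) :
    MemLp (fun ω => ∑ i, X i (ω i)) 2 (Measure.pi μ) :=
  memLp_finsetSum _ fun i _ => (hX i).comp_measurePreserving (measurePreserving_eval μ i)

theorem integral_pi_sum_eq_zero (hX : ∀ i, MemLp (X i) 2 (μ i)) (h0 : ∀ i, ∫ t, X i t ∂μ i = 0) :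
    ∫ ω, ∑ i, X i (ω i) ∂(Measure.pi μ) = 0 := by
  have hm (i : ι) : MemLp (fun ω : ∀ i, Ω i => X i (ω i)) 2 (Measure.pi μ) :=
    (hX i).comp_measurePreserving (measurePreserving_eval μ i)
  rw [integral_finsetSum _ fun i _ => (hm i).integrable one_le_two]
  refine Finset.sum_eq_zero fun i _ => ?_
  rw [integral_comp_eval (hX i).aestronglyMeasurable, h0 i]

theorem lintegral_pi_sum_sq (hX : ∀ i, MemLp (X i) 2 (μ i)) (h0 : ∀ i, ∫ t, X i t ∂μ i = 0) :
    ∫⁻ ω, ENNReal.ofReal ((∑ i, X i (ω i)) ^ 2) ∂(Measure.pi μ) =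
      ∑ i, ∫⁻ t, ENNReal.ofReal (X i t ^ 2) ∂μ i := by
  have hvar : variance (fun ω => ∑ i, X i (ω i)) (Measure.pi μ) = ∑ i, variance (X i) (μ i) := by
    simpa only [Finset.sum_fn] using variance_sum_pi hX
  rw [lintegral_ofReal_sq_eq_variance (memLp_pi_sum hX) (integral_pi_sum_eq_zero hX h0), hvar,
    ENNReal.ofReal_sum_of_nonneg fun i _ => variance_nonneg _ _]
  simp only [fun i => lintegral_ofReal_sq_eq_variance (hX i) (h0 i)]

end Moments

section Laws

variable {P : Measure ℝ} {σ : ℝ} {act : Activation}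

/-- A probability law on `ℝ` with mean zero and variance `σ²`: what the moment computations for
linear networks use of the law of the weights. -/
structure IsCenteredLaw (P : Measure ℝ) (σ : ℝ) : Prop where
  isProbabilityMeasure : IsProbabilityMeasure P
  memLp_two : MemLp id 2 P
  integral_eq_zero : ∫ t, t ∂P = 0
  variance_eq : variance id P = σ ^ 2

/-- The laws of the weights for which second moments propagate through the layers of the network:
symmetry is only asked for ReLU networks, where it makes a gate pass half of the second moment. -/
structure Activation.IsAdmissibleLaw (act : Activation) (P : Measure ℝ) (σ : ℝ) : Prop
    extends IsCenteredLaw P σ where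
  symmetric : act = relu → P.map (fun t => -t) = P

theorem IsInitLaw.isAdmissibleLaw (hP : IsInitLaw P σ) : act.IsAdmissibleLaw P σ where
  isProbabilityMeasure := hP.isProbabilityMeasure
  memLp_two :=
    have := hP.isProbabilityMeasure
    hP.memLp_four.mono_exponent (by norm_num)
  integral_eq_zero := by
    have hneg : ∫ t, t ∂P = ∫ t, -t ∂P := by
      conv_lhs => rw [← hP.symmetric]
      rw [integral_map measurable_neg.aemeasurable (by fun_prop)]
    rwa [integral_neg, self_eq_neg] at hneg
  variance_eq := hP.variance_eq
  symmetric := fun _ => hP.symmetric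

theorem IsCenteredLaw.lintegral_sq (hP : IsCenteredLaw P σ) :
    ∫⁻ t, ENNReal.ofReal (t ^ 2) ∂P = ENNReal.ofReal (σ ^ 2) :=
  (lintegral_ofReal_sq_eq_variance hP.memLp_two hP.integral_eq_zero).trans
    (congrArg ENNReal.ofReal hP.variance_eq)

end Laws

namespace Activation

theorem measurable_gate (act : Activation) : Measurable act.gate := by
  cases act with
  | linear => exact measurable_const
  | relu => exact Measurable.ite measurableSet_Ioi measurable_const measurable_const

theorem continuous_apply (act : Activation) : Continuous act.apply := by
  cases act with
  | linear => exact continuous_id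
  | relu => exact continuous_id.max continuous_const

theorem gate_sq_le_one (act : Activation) (t : ℝ) : act.gate t ^ 2 ≤ 1 := by
  cases act with
  | linear => simp [gate]
  | relu => by_cases h : 0 < t <;> simp [gate, h]

theorem relu_gate_sq_add_gate_neg_sq_le_one (t : ℝ) :
    relu.gate t ^ 2 + relu.gate (-t) ^ 2 ≤ 1 := by
  rcases lt_trichotomy t 0 with h | h | h
  · simp [gate, h, h.not_gt]
  · simp [gate, h]
  · simp [gate, h, h.not_gt]

theorem p_nonneg (act : Activation) : 0 ≤ act.p := by
  cases act <;> norm_num [p]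

end Activation

section Rows

variable {P : Measure ℝ} {σ : ℝ} {act : Activation} {ι κ τ : Type*} [Fintype ι] [Fintype κ]
  [Fintype τ]

theorem ofReal_euclNorm_sq (v : ι → ℝ) :
    ENNReal.ofReal (euclNorm v ^ 2) = ∑ i, ENNReal.ofReal (v i ^ 2) := by
  rw [euclNorm_sq, ENNReal.ofReal_sum_of_nonneg fun i _ => sq_nonneg (v i)]

theorem ofReal_frobNorm_sq_eq_sum_col (M : Matrix ι κ ℝ) :
    ENNReal.ofReal (frobNorm M ^ 2) = ∑ j, ENNReal.ofReal (euclNorm (M.col j) ^ 2) := by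
  rw [frobNorm_sq_eq_sum_col, ENNReal.ofReal_sum_of_nonneg fun j _ => sq_nonneg _]

theorem measurable_euclNorm : Measurable (euclNorm : (ι → ℝ) → ℝ) := by
  unfold euclNorm
  fun_prop

theorem measurable_dotProduct_const (u : ι → ℝ) : Measurable fun w : ι → ℝ => w ⬝ᵥ u := by
  unfold dotProduct
  fun_prop

omit [Fintype ι] in
theorem measurable_of_mulVec (u : κ → ℝ) :
    Measurable fun M : ι → κ → ℝ => Matrix.of M *ᵥ u :=
  measurable_pi_lambda _ fun i => (measurable_dotProduct_const u).comp (measurable_pi_apply i)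

/-- The law of a vector with i.i.d. entries of law `P`. -/
noncomputable abbrev rowLaw (P : Measure ℝ) (ι : Type*) [Fintype ι] : Measure (ι → ℝ) :=
  Measure.pi fun _ => P

/-- The law of the rows of a matrix with i.i.d. entries of law `P`. -/
noncomputable abbrev matLaw (P : Measure ℝ) (ι κ : Type*) [Fintype ι] [Fintype κ] :
    Measure (ι → κ → ℝ) :=
  Measure.pi fun _ => rowLaw P κ

namespace IsCenteredLaw

theorem memLp_dotProduct (hP : IsCenteredLaw P σ) (u : ι → ℝ) :
    MemLp (fun w : ι → ℝ => w ⬝ᵥ u) 2 (rowLaw P ι) := by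
  have := hP.isProbabilityMeasure
  exact memLp_pi_sum (X := fun i t => t * u i) fun i => hP.memLp_two.mul_const (u i)

theorem integral_dotProduct (hP : IsCenteredLaw P σ) (u : ι → ℝ) :
    ∫ w, w ⬝ᵥ u ∂(rowLaw P ι) = 0 := by
  have := hP.isProbabilityMeasure
  refine integral_pi_sum_eq_zero (X := fun i t => t * u i)
    (fun i => hP.memLp_two.mul_const (u i)) fun i => ?_
  rw [integral_mul_const, hP.integral_eq_zero, zero_mul]

theorem lintegral_dotProduct_sq (hP : IsCenteredLaw P σ) (u : ι → ℝ) :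
    ∫⁻ w, ENNReal.ofReal ((w ⬝ᵥ u) ^ 2) ∂(rowLaw P ι) =
      ENNReal.ofReal (σ ^ 2 * euclNorm u ^ 2) := by
  have := hP.isProbabilityMeasure
  refine (lintegral_pi_sum_sq (X := fun i t => t * u i)
    (fun i => hP.memLp_two.mul_const (u i)) fun i => ?_).trans ?_
  · rw [integral_mul_const, hP.integral_eq_zero, zero_mul]
  · rw [ENNReal.ofReal_mul (sq_nonneg σ), ofReal_euclNorm_sq, Finset.mul_sum]
    refine Finset.sum_congr rfl fun i _ => ?_
    simp only [mul_pow, ENNReal.ofReal_mul (sq_nonneg _)]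
    rw [lintegral_mul_const _ (by fun_prop), hP.lintegral_sq]

theorem lintegral_mulVec_mulVec_sq (hP : IsCenteredLaw P σ) (B : Matrix τ ι ℝ) (u : κ → ℝ) :
    ∫⁻ M, ENNReal.ofReal (euclNorm (B *ᵥ (Matrix.of M *ᵥ u)) ^ 2) ∂(matLaw P ι κ) =
      ENNReal.ofReal (σ ^ 2 * frobNorm B ^ 2 * euclNorm u ^ 2) := by
  have := hP.isProbabilityMeasure
  have hrow (o : τ) : ∫⁻ M, ENNReal.ofReal ((B *ᵥ (Matrix.of M *ᵥ u)) o ^ 2) ∂(matLaw P ι κ) =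
      ENNReal.ofReal (euclNorm (B o) ^ 2) * ENNReal.ofReal (σ ^ 2 * euclNorm u ^ 2) := by
    refine (lintegral_pi_sum_sq (X := fun i w => B o i * (w ⬝ᵥ u))
      (fun i => (hP.memLp_dotProduct u).const_mul (B o i)) fun i => ?_).trans ?_
    · rw [integral_const_mul, hP.integral_dotProduct, mul_zero]
    · rw [ofReal_euclNorm_sq, Finset.sum_mul]
      refine Finset.sum_congr rfl fun i _ => ?_
      simp only [mul_pow, ENNReal.ofReal_mul (sq_nonneg (B o i))]
      rw [lintegral_const_mul _ ((measurable_dotProduct_const u).pow_const 2).ennreal_ofReal,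
        hP.lintegral_dotProduct_sq]
  simp only [ofReal_euclNorm_sq]
  rw [lintegral_finsetSum _ fun o _ => ?_]
  · simp only [hrow]
    rw [← Finset.sum_mul, ← ENNReal.ofReal_sum_of_nonneg fun o _ => sq_nonneg _,
      ← frobNorm_sq_eq_sum_row, ← ENNReal.ofReal_mul (sq_nonneg _)]
    ring_nf
  · have hB : Measurable fun M : ι → κ → ℝ => (B *ᵥ (Matrix.of M *ᵥ u)) o := by
      have hcont : Continuous fun M : ι → κ → ℝ => B *ᵥ (Matrix.of M *ᵥ u) := by
        refine continuous_const.matrix_mulVec (Continuous.matrix_mulVec ?_ continuous_const)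
        exact continuous_id
      exact (measurable_pi_apply o).comp hcont.measurable
    fun_prop

theorem lintegral_mulVec_sq (hP : IsCenteredLaw P σ) (u : κ → ℝ) :
    ∫⁻ M, ENNReal.ofReal (euclNorm (Matrix.of M *ᵥ u) ^ 2) ∂(matLaw P ι κ) =
      ENNReal.ofReal (Fintype.card ι * σ ^ 2 * euclNorm u ^ 2) := by
  classical
  have hone : frobNorm (1 : Matrix ι ι ℝ) ^ 2 = Fintype.card ι := by
    simp [frobNorm_sq, Matrix.one_apply]
  have h := hP.lintegral_mulVec_mulVec_sq (1 : Matrix ι ι ℝ) u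
  simp only [Matrix.one_mulVec] at h
  rw [h, hone, mul_comm (σ ^ 2)]

theorem lintegral_frobNorm_mul_sq (hP : IsCenteredLaw P σ) (N : Matrix κ τ ℝ) :
    ∫⁻ M, ENNReal.ofReal (frobNorm (Matrix.of M * N) ^ 2) ∂(matLaw P ι κ) =
      ENNReal.ofReal (Fintype.card ι * σ ^ 2 * frobNorm N ^ 2) := by
  have hcol (M : ι → κ → ℝ) (j : τ) : (Matrix.of M * N).col j = Matrix.of M *ᵥ N.col j := rfl
  have hmeas (j : τ) : Measurable fun M : ι → κ → ℝ =>
      ENNReal.ofReal (euclNorm (Matrix.of M *ᵥ N.col j) ^ 2) :=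
    ((measurable_euclNorm.comp (measurable_of_mulVec _)).pow_const 2).ennreal_ofReal
  simp only [ofReal_frobNorm_sq_eq_sum_col, hcol]
  rw [lintegral_finsetSum _ fun j _ => hmeas j]
  simp only [hP.lintegral_mulVec_sq]
  rw [frobNorm_sq_eq_sum_col, Finset.mul_sum, ENNReal.ofReal_sum_of_nonneg fun j _ => by positivity]

end IsCenteredLaw

theorem Activation.lintegral_relu_gate_mul_sq_le {μ : Measure (ι → ℝ)}
    (hμ : MeasurePreserving (fun w => -w) μ μ) (u v : ι → ℝ) :
    ∫⁻ w, ENNReal.ofReal ((relu.gate (w ⬝ᵥ v) * (w ⬝ᵥ u)) ^ 2) ∂μ ≤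
      (∫⁻ w, ENNReal.ofReal ((w ⬝ᵥ u) ^ 2) ∂μ) / 2 := by
  have hg := relu.measurable_gate
  have hu := measurable_dotProduct_const u
  have hv := measurable_dotProduct_const v
  have hf : Measurable fun w : ι → ℝ => ENNReal.ofReal ((relu.gate (w ⬝ᵥ v) * (w ⬝ᵥ u)) ^ 2) := by
    fun_prop
  rw [ENNReal.le_div_iff_mul_le (by simp) (by simp), mul_two]
  nth_rewrite 2 [← hμ.lintegral_comp hf]
  rw [← lintegral_add_left hf]
  refine lintegral_mono fun w => ?_
  rw [neg_dotProduct, neg_dotProduct, mul_pow, mul_pow, neg_sq (w ⬝ᵥ u),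
    ← ENNReal.ofReal_add (by positivity) (by positivity), ← add_mul]
  exact ENNReal.ofReal_le_ofReal
    (mul_le_of_le_one_left (sq_nonneg _) (relu_gate_sq_add_gate_neg_sq_le_one _))

namespace Activation.IsAdmissibleLaw

theorem lintegral_gate_mul_sq_le (hP : act.IsAdmissibleLaw P σ) (u v : ι → ℝ) :
    ∫⁻ w, ENNReal.ofReal ((act.gate (w ⬝ᵥ v) * (w ⬝ᵥ u)) ^ 2) ∂(rowLaw P ι) ≤
      ENNReal.ofReal (act.p * σ ^ 2 * euclNorm u ^ 2) := by
  have := hP.isProbabilityMeasure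
  cases act with
  | linear => simp [gate, p, hP.lintegral_dotProduct_sq]
  | relu =>
    have hneg : MeasurePreserving (fun w : ι → ℝ => -w) (rowLaw P ι) (rowLaw P ι) :=
      measurePreserving_pi _ _ fun _ => ⟨measurable_neg, hP.symmetric rfl⟩
    refine (lintegral_relu_gate_mul_sq_le hneg u v).trans_eq ?_
    rw [hP.lintegral_dotProduct_sq, ← ENNReal.ofReal_ofNat, ← ENNReal.ofReal_div_of_pos two_pos]
    simp only [p]
    ring_nf

theorem lintegral_gate_mulVec_sq_le (hP : act.IsAdmissibleLaw P σ) (u v : κ → ℝ) :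
    ∫⁻ M, ENNReal.ofReal (euclNorm (fun i => act.gate ((Matrix.of M *ᵥ v) i) *
        (Matrix.of M *ᵥ u) i) ^ 2) ∂(matLaw P ι κ) ≤
      ENNReal.ofReal (act.p * Fintype.card ι * σ ^ 2 * euclNorm u ^ 2) := by
  have := hP.isProbabilityMeasure
  have hg := act.measurable_gate
  have hu := measurable_dotProduct_const u
  have hv := measurable_dotProduct_const v
  have hf : Measurable fun w : κ → ℝ =>
      ENNReal.ofReal ((act.gate (w ⬝ᵥ v) * (w ⬝ᵥ u)) ^ 2) := by fun_prop
  calc _ = ∑ i : ι, ∫⁻ M, ENNReal.ofReal ((act.gate (M i ⬝ᵥ v) * (M i ⬝ᵥ u)) ^ 2)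
          ∂(matLaw P ι κ) := by
        simp only [ofReal_euclNorm_sq]
        exact lintegral_finsetSum _ fun i _ => hf.comp (measurable_pi_apply i)
    _ ≤ ∑ _i : ι, ENNReal.ofReal (act.p * σ ^ 2 * euclNorm u ^ 2) := by
        gcongr with i
        rw [(measurePreserving_eval (fun _ : ι => rowLaw P κ) i).lintegral_comp hf]
        exact hP.lintegral_gate_mul_sq_le u v
    _ = _ := by
        rw [Finset.sum_const, Finset.card_univ, nsmul_eq_mul, ← ENNReal.ofReal_natCast,
          ← ENNReal.ofReal_mul (Nat.cast_nonneg _)]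
        ring_nf

end Activation.IsAdmissibleLaw

end Rows

section Measurability

variable {Ω : Type*} [MeasurableSpace Ω] {ι κ τ : Type*}

theorem measurable_mulVec [Fintype κ] {M : Ω → Matrix ι κ ℝ} {v : Ω → κ → ℝ}
    (hM : ∀ i j, Measurable fun θ => M θ i j) (hv : Measurable v) :
    Measurable fun θ => M θ *ᵥ v θ := by
  refine measurable_pi_lambda _ fun i => ?_
  simp only [Matrix.mulVec, dotProduct]
  fun_prop

theorem measurable_mul_apply [Fintype κ] {M : Ω → Matrix ι κ ℝ} {N : Ω → Matrix κ τ ℝ}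
    (hM : ∀ i j, Measurable fun θ => M θ i j) (hN : ∀ i j, Measurable fun θ => N θ i j)
    (i : ι) (j : τ) : Measurable fun θ => (M θ * N θ) i j := by
  simp only [Matrix.mul_apply]
  fun_prop

theorem measurable_diagonal_apply [DecidableEq ι] {v : Ω → ι → ℝ} (hv : Measurable v) (i j : ι) :
    Measurable fun θ => Matrix.diagonal (v θ) i j := by
  by_cases h : i = j
  · subst h
    simpa using hv.eval
  · simp [h]

theorem measurable_frobNorm [Fintype ι] [Fintype κ] {M : Ω → Matrix ι κ ℝ}
    (hM : ∀ i j, Measurable fun θ => M θ i j) : Measurable fun θ => frobNorm (M θ) := by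
  unfold frobNorm
  fun_prop

theorem measurable_ofReal_euclNorm_sq [Fintype ι] {v : Ω → ι → ℝ} (hv : Measurable v) :
    Measurable fun θ => ENNReal.ofReal (euclNorm (v θ) ^ 2) :=
  ((measurable_euclNorm.comp hv).pow_const 2).ennreal_ofReal

theorem measurable_ofReal_frobNorm_sq [Fintype ι] [Fintype κ] {M : Ω → Matrix ι κ ℝ}
    (hM : ∀ i j, Measurable fun θ => M θ i j) :
    Measurable fun θ => ENNReal.ofReal (frobNorm (M θ) ^ 2) :=
  ((measurable_frobNorm hM).pow_const 2).ennreal_ofReal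

variable {L d dIn dOut n : ℕ} (act : Activation) {W : Ω → Weights L d} (hW : Measurable W)

include hW

theorem measurable_layer_apply (b : ℕ) (i j : Fin d) : Measurable fun θ => layer (W θ) b i j :=
  (contDiff_layer_apply b i j).continuous.measurable.comp hW

omit [MeasurableSpace Ω] hW in
theorem preact_succ (W : Weights L d) (z : Fin d → ℝ) (b : ℕ) :
    preact act W z (b + 1) = layer W b *ᵥ fun i => act.apply (preact act W z b i) := by
  by_cases h : b < L <;> simp [preact, layer, h]

theorem measurable_preact {z : Ω → Fin d → ℝ} (hz : Measurable z) (b : ℕ) :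
    Measurable fun θ => preact act (W θ) (z θ) b := by
  induction b with
  | zero => exact hz
  | succ b ih =>
    simp only [preact_succ]
    have hact := act.continuous_apply.measurable
    exact measurable_mulVec (measurable_layer_apply hW b) (by fun_prop)

theorem measurable_gates {z : Ω → Fin d → ℝ} (hz : Measurable z) (b : ℕ) :
    Measurable fun θ => gates act (W θ) (z θ) b :=
  measurable_pi_lambda _ fun _ => act.measurable_gate.comp (measurable_preact act hW hz b).eval

theorem measurable_chain_apply {z : Ω → Fin d → ℝ} (hz : Measurable z) (a b : ℕ) (i j : Fin d) :
    Measurable fun θ => chain (gates act (W θ) (z θ)) (W θ) a b i j := by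
  induction b generalizing i j with
  | zero => exact measurable_diagonal_apply (measurable_gates act hW hz 0) i j
  | succ b ih =>
    have hdiag := measurable_diagonal_apply (measurable_gates act hW hz (b + 1))
    by_cases hab : a ≤ b
    · simp only [chain, if_pos hab]
      exact measurable_mul_apply hdiag (measurable_mul_apply (measurable_layer_apply hW b) ih) i j
    · simp only [chain, if_neg hab]
      exact hdiag i j

theorem measurable_chain_mulVec {z : Ω → Fin d → ℝ} (hz : Measurable z) (a b : ℕ)
    {u : Ω → Fin d → ℝ} (hu : Measurable u) :
    Measurable fun θ => chain (gates act (W θ) (z θ)) (W θ) a b *ᵥ u θ :=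
  measurable_mulVec (measurable_chain_apply act hW hz a b) hu

variable {B : Ω → Matrix (Fin dOut) (Fin d) ℝ} (hB : ∀ o i, Measurable fun θ => B θ o i)

include hB

theorem measurable_netOut {z : Ω → Fin d → ℝ} (hz : Measurable z) :
    Measurable fun θ => netOut (B θ) (gates act (W θ) (z θ)) (z θ) (W θ) :=
  measurable_mulVec hB (measurable_chain_mulVec act hW hz 0 L hz)

theorem measurable_jac_apply {z : Ω → Fin d → ℝ} (hz : Measurable z) (k : ℕ) (a : Fin d × Fin d)
    (o : Fin dOut) : Measurable fun θ => jac (B θ) (gates act (W θ) (z θ)) (z θ) (W θ) k a o :=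
  (measurable_mul_apply hB (measurable_chain_apply act hW hz _ _) o a.1).mul
    (measurable_chain_mulVec act hW hz _ _ hz).eval

theorem measurable_jac₂_apply {z : Ω → Fin d → ℝ} (hz : Measurable z) (k l : ℕ)
    (ab : (Fin d × Fin d) × Fin d × Fin d) (o : Fin dOut) :
    Measurable fun θ => jac₂ (B θ) (gates act (W θ) (z θ)) (z θ) (W θ) k l ab o :=
  (measurable_mul_apply hB (measurable_chain_apply act hW hz _ _) o ab.2.1).mul
    ((measurable_chain_apply act hW hz _ _ ab.2.2 ab.1.1).mul
      (measurable_chain_mulVec act hW hz _ _ hz).eval)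

variable {A : Ω → Matrix (Fin d) (Fin dIn) ℝ} (hA : ∀ i j, Measurable fun θ => A θ i j)
  (x : Fin n → Fin dIn → ℝ) (y : Fin n → Fin dOut → ℝ)

include hA

theorem measurable_gradNorm (k : Fin L) :
    Measurable fun θ => gradNorm act (A θ) (B θ) x y (W θ) k := by
  have hz (s : Fin n) : Measurable fun θ => A θ *ᵥ x s := measurable_mulVec hA measurable_const
  have hres (s : Fin n) := (measurable_netOut act hW hB (hz s)).sub_const (y s)
  refine measurable_frobNorm fun i j => ?_
  simp only [gradBlock_gatedLoss, Matrix.smul_apply, Matrix.sum_apply, Matrix.of_apply,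
    smul_eq_mul]
  exact (Finset.measurable_fun_sum _ fun s _ => (measurable_mulVec
    (measurable_jac_apply act hW hB (hz s) k) (hres s)).eval).const_mul _

theorem measurable_hessNorm (k l : Fin L) :
    Measurable fun θ => hessNorm act (A θ) (B θ) x y (W θ) k l := by
  wlog hkl : k ≤ l generalizing k l
  · simp only [hessNorm_comm act _ _ x y _ k l]
    exact this l k (le_of_not_ge hkl)
  have hz (s : Fin n) : Measurable fun θ => A θ *ᵥ x s := measurable_mulVec hA measurable_const
  have hres (s : Fin n) := (measurable_netOut act hW hB (hz s)).sub_const (y s)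
  have hjac (s : Fin n) := measurable_jac_apply act hW hB (hz s)
  have hmul (s : Fin n) := measurable_mul_apply
    (N := fun θ => (jac (B θ) (gates act (W θ) (A θ *ᵥ x s)) (A θ *ᵥ x s) (W θ) l)ᵀ)
    (hjac s k) fun o b => hjac s l b o
  refine measurable_frobNorm fun a b => ?_
  rcases hkl.eq_or_lt with rfl | hlt
  · simp only [hessBlock_gatedLoss_self, Matrix.smul_apply, Matrix.sum_apply, smul_eq_mul]
    exact (Finset.measurable_fun_sum _ fun s _ => hmul s a b).const_mul _
  · simp only [hessBlock_gatedLoss_of_lt _ _ _ _ _ _ hlt, Matrix.smul_apply, Matrix.sum_apply,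
      Matrix.add_apply, Matrix.of_apply, smul_eq_mul]
    refine (Finset.measurable_fun_sum _ fun s _ => (hmul s a b).fun_add ?_).const_mul _
    exact (measurable_mulVec (measurable_jac₂_apply act hW hB (hz s) k l) (hres s)).eval

end Measurability

section Conditioning

variable {L d : ℕ} {P : Measure ℝ} {act : Activation} {a b : ℕ} {S T T' : Weights L d → ℝ≥0∞}
  {K K' : ℝ≥0∞}

instance isProbabilityMeasure_initLaw [IsProbabilityMeasure P] :
    IsProbabilityMeasure (initLaw P L d) := by
  unfold initLaw
  infer_instance

/-- The conditional expectation of `T` given the weight matrices with index below `a` is at most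
`K`. This is tested against the non-negative functions `g` of these matrices, which avoids
conditional expectations as random variables. -/
def CondExpLE (P : Measure ℝ) (a : ℕ) (T : Weights L d → ℝ≥0∞) (K : ℝ≥0∞) : Prop :=
  ∀ g : Weights L d → ℝ≥0∞, Measurable g → DependsOn g {j | (j : ℕ) < a} →
    ∫⁻ W, g W * T W ∂(initLaw P L d) ≤ K * ∫⁻ W, g W ∂(initLaw P L d)

namespace CondExpLE

theorem lintegral_le [IsProbabilityMeasure P] (h : CondExpLE P a T K) :
    ∫⁻ W, T W ∂(initLaw P L d) ≤ K := by
  simpa using h (fun _ => 1) measurable_const fun _ _ _ => rfl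

theorem of_forall_le (h : ∀ W, T W ≤ K) : CondExpLE P a T K := by
  intro g hg _
  rw [← lintegral_const_mul K hg]
  refine lintegral_mono fun W => ?_
  rw [mul_comm]
  exact mul_le_mul_left (h W) _

theorem mono (h : CondExpLE P a T K) (hT : ∀ W, T' W ≤ T W) : CondExpLE P a T' K :=
  fun g hg hdep => (lintegral_mono fun W => mul_le_mul_right (hT W) _).trans (h g hg hdep)

theorem const_mul (h : CondExpLE P a T K) (hT : Measurable T) (c : ℝ≥0∞) :
    CondExpLE P a (fun W => c * T W) (c * K) := by
  intro g hg hdep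
  have hgT : Measurable fun W => g W * T W := hg.mul hT
  simp only [mul_left_comm _ c]
  rw [lintegral_const_mul c hgT, mul_assoc]
  exact mul_le_mul_right (h g hg hdep) c

theorem sum {ι : Type*} {s : Finset ι} {T : ι → Weights L d → ℝ≥0∞} {K : ι → ℝ≥0∞}
    (h : ∀ i ∈ s, CondExpLE P a (T i) (K i)) (hT : ∀ i ∈ s, Measurable (T i)) :
    CondExpLE P a (fun W => ∑ i ∈ s, T i W) (∑ i ∈ s, K i) := by
  intro g hg hdep
  simp only [Finset.mul_sum, Finset.sum_mul]
  have hgT : ∀ i ∈ s, Measurable fun W => g W * T i W := fun i hi => hg.mul (hT i hi)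
  rw [lintegral_finsetSum s hgT]
  exact Finset.sum_le_sum fun i hi => h i hi g hg hdep

theorem mul (hT : CondExpLE P b T K) (hS : CondExpLE P a S K') (hab : a ≤ b)
    (hmeas : Measurable S) (hdep : DependsOn S {j | (j : ℕ) < b}) :
    CondExpLE P a (fun W => T W * S W) (K * K') := by
  intro g hg hgdep
  have hgS : DependsOn (fun W => g W * S W) {j | (j : ℕ) < b} := fun V W h =>
    congrArg₂ (· * ·) (hgdep fun j hj => h j (lt_of_lt_of_le hj hab)) (hdep h)
  simp only [← mul_assoc, mul_right_comm _ (T _)]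
  refine (hT _ (hg.mul hmeas) hgS).trans ?_
  rw [mul_assoc]
  exact mul_le_mul_right (hS g hg hgdep) K

theorem of_update [IsProbabilityMeasure P] {b : Fin L} (hS : CondExpLE P a S K') (hab : a ≤ b)
    (hmeasS : Measurable S) (hmeasT : Measurable T)
    (h : ∀ W, ∫⁻ w, T (Function.update W b w) ∂(matLaw P (Fin d) (Fin d)) ≤ K * S W) :
    CondExpLE P a T (K * K') := by
  intro g hg hdep
  have hgb (W : Weights L d) (w : Fin d → Fin d → ℝ) : g (Function.update W b w) = g W :=
    hdep fun j (hj : (j : ℕ) < a) =>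
      Function.update_of_ne (fun hjb => (hj.trans_le hab).ne (congrArg Fin.val hjb)) w W
  refine (lintegral_mul_le_of_update _ hg hmeasT hmeasS hgb h).trans ?_
  rw [mul_assoc]
  exact mul_le_mul_right (hS g hg hdep) K

end CondExpLE

theorem layer_congr {V W : Weights L d} (h : ∀ j ∈ {j : Fin L | (j : ℕ) < a}, V j = W j) {m : ℕ}
    (hm : m < a) : layer V m = layer W m := by
  by_cases hmL : m < L
  · simp only [layer, hmL, dite_true, h ⟨m, hmL⟩ hm]
  · simp only [layer, hmL, dite_false]

theorem dependsOn_preact (act : Activation) (z : Fin d → ℝ) (b : ℕ) :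
    DependsOn (fun W : Weights L d => preact act W z b) {j | (j : ℕ) < b} := by
  induction b with
  | zero => exact fun _ _ _ => rfl
  | succ b ih =>
    intro V W h
    have hb : preact act V z b = preact act W z b := ih fun j hj => h j (Nat.lt_succ_of_lt hj)
    simp only [preact_succ, hb, layer_congr h b.lt_succ_self]

theorem dependsOn_gates (act : Activation) (z : Fin d → ℝ) (b : ℕ) :
    DependsOn (fun W : Weights L d => gates act W z b) {j | (j : ℕ) < b} := fun _ _ h =>
  funext fun i => congrArg act.gate (congrFun (dependsOn_preact act z b h) i)

theorem dependsOn_chain (act : Activation) (z : Fin d → ℝ) (a b : ℕ) :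
    DependsOn (fun W : Weights L d => chain (gates act W z) W a b) {j | (j : ℕ) < b} := by
  induction b with
  | zero => exact fun _ _ h => congrArg Matrix.diagonal (dependsOn_gates act z 0 h)
  | succ b ih =>
    intro V W h
    have hb : chain (gates act V z) V a b = chain (gates act W z) W a b :=
      ih fun j hj => h j (Nat.lt_succ_of_lt hj)
    have hgates : gates act V z (b + 1) = gates act W z (b + 1) := dependsOn_gates act z _ h
    simp only [chain, hb, hgates, layer_congr h b.lt_succ_self]

end Conditioning

section ChainMoments

variable {L d : ℕ} {P : Measure ℝ} {σ : ℝ} {act : Activation} {a b : ℕ}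

theorem lam_nonneg (act : Activation) (d : ℕ) (σ : ℝ) : 0 ≤ lam act d σ := by
  have := act.p_nonneg
  unfold lam
  positivity

theorem CondExpLE.frobNorm_sq {ι κ : Type*} [Fintype ι] [Fintype κ] {M : Weights L d → Matrix ι κ ℝ}
    {K : ℝ} (hM : ∀ i j, Measurable fun W => M W i j)
    (h : ∀ u : κ → ℝ, CondExpLE P a (fun W => ENNReal.ofReal (euclNorm (M W *ᵥ u) ^ 2))
      (ENNReal.ofReal (K * euclNorm u ^ 2))) :
    CondExpLE P a (fun W => ENNReal.ofReal (frobNorm (M W) ^ 2))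
      (ENNReal.ofReal (Fintype.card κ * K)) := by
  classical
  have hcol (j : κ) : CondExpLE P a (fun W => ENNReal.ofReal (euclNorm ((M W).col j) ^ 2))
      (ENNReal.ofReal K) := by
    have hunit : euclNorm (Pi.single j (1 : ℝ)) ^ 2 = 1 := by
      simp [euclNorm_sq, Pi.single_apply]
    simpa only [Matrix.mulVec_single_one, hunit, mul_one] using h (Pi.single j 1)
  have hmeas (j : κ) : Measurable fun W => ENNReal.ofReal (euclNorm ((M W).col j) ^ 2) :=
    measurable_ofReal_euclNorm_sq (measurable_pi_lambda _ fun i => hM i j)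
  have hsum : ∑ _j : κ, ENNReal.ofReal K = ENNReal.ofReal (Fintype.card κ * K) := by
    rw [Finset.sum_const, Finset.card_univ, nsmul_eq_mul, ENNReal.ofReal_mul (Nat.cast_nonneg _),
      ENNReal.ofReal_natCast]
  simp only [ofReal_frobNorm_sq_eq_sum_col]
  rw [← hsum]
  exact CondExpLE.sum (fun j _ => hcol j) fun j _ => hmeas j

theorem euclNorm_diagonal_gates_mulVec_sq_le (W : Weights L d) (z u : Fin d → ℝ) (b : ℕ) :
    euclNorm (Matrix.diagonal (gates act W z b) *ᵥ u) ^ 2 ≤ euclNorm u ^ 2 := by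
  simp only [euclNorm_sq, Matrix.mulVec_diagonal, mul_pow]
  exact Finset.sum_le_sum fun i _ =>
    mul_le_of_le_one_left (sq_nonneg _) (act.gate_sq_le_one _)

theorem chain_update_mulVec (act : Activation) (W : Weights L d) {b : Fin L} (hab : a ≤ b)
    (w : Fin d → Fin d → ℝ) (z u : Fin d → ℝ) :
    chain (gates act (Function.update W b w) z) (Function.update W b w) a (b + 1) *ᵥ u =
      fun i => act.gate ((Matrix.of w *ᵥ fun j => act.apply (preact act W z b j)) i) *
        (Matrix.of w *ᵥ (chain (gates act W z) W a b *ᵥ u)) i := by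
  have hbelow : ∀ j ∈ {j : Fin L | (j : ℕ) < b}, Function.update W b w j = W j :=
    fun j (hj : (j : ℕ) < b) => Function.update_of_ne (fun e => hj.ne (congrArg Fin.val e)) w W
  have hlayer : layer (Function.update W b w) b = Matrix.of w := by simp [layer]
  have hpreact : preact act (Function.update W b w) z b = preact act W z b :=
    dependsOn_preact act z b hbelow
  have hchain : chain (gates act (Function.update W b w) z) (Function.update W b w) a b =
      chain (gates act W z) W a b := dependsOn_chain act z a b hbelow
  ext i
  rw [chain_succ _ _ hab, ← Matrix.mulVec_mulVec, Matrix.mulVec_diagonal, ← Matrix.mulVec_mulVec,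
    hchain, hlayer, gates, preact_succ, hlayer, hpreact]

theorem measurable_ofReal_chain_mulVec_sq (act : Activation) (z u : Fin d → ℝ) (a b : ℕ) :
    Measurable fun W : Weights L d =>
      ENNReal.ofReal (euclNorm (chain (gates act W z) W a b *ᵥ u) ^ 2) := by
  have hchain : Measurable fun W : Weights L d => chain (gates act W z) W a b *ᵥ u :=
    measurable_chain_mulVec act measurable_id' measurable_const a b measurable_const
  exact measurable_ofReal_euclNorm_sq hchain

theorem measurable_ofReal_chain_sq (act : Activation) (z : Fin d → ℝ) (a b : ℕ) :
    Measurable fun W : Weights L d =>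
      ENNReal.ofReal (frobNorm (chain (gates act W z) W a b) ^ 2) :=
  measurable_ofReal_frobNorm_sq (measurable_chain_apply act measurable_id' measurable_const a b)

theorem condExpLE_chain_mulVec (hP : act.IsAdmissibleLaw P σ) (z u : Fin d → ℝ) (hab : a ≤ b)
    (hbL : b ≤ L) :
    CondExpLE P a
      (fun W : Weights L d =>
        ENNReal.ofReal (euclNorm (chain (gates act W z) W a b *ᵥ u) ^ 2))
      (ENNReal.ofReal (lam act d σ ^ (b - a) * euclNorm u ^ 2)) := by
  have := hP.isProbabilityMeasure
  have hmeas := measurable_ofReal_chain_mulVec_sq (L := L) act z u a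
  induction b, hab using Nat.le_induction with
  | base =>
    refine CondExpLE.of_forall_le fun W => ENNReal.ofReal_le_ofReal ?_
    rw [chain_self, Nat.sub_self, pow_zero, one_mul]
    exact euclNorm_diagonal_gates_mulVec_sq_le W z u a
  | succ b hab ih =>
    have hlam := lam_nonneg act d σ
    have hstep := CondExpLE.of_update (b := ⟨b, hbL⟩) (K := ENNReal.ofReal (lam act d σ))
      (ih (Nat.le_of_succ_le hbL)) hab (hmeas b) (hmeas (b + 1)) fun W => ?_
    · rwa [← ENNReal.ofReal_mul hlam, ← mul_assoc, ← pow_succ', ← Nat.sub_add_comm hab] at hstep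
    · simp only [chain_update_mulVec act W (b := ⟨b, hbL⟩) hab]
      rw [← ENNReal.ofReal_mul hlam]
      simpa only [lam, Fintype.card_fin] using hP.lintegral_gate_mulVec_sq_le (ι := Fin d) _ _

theorem condExpLE_chain (hP : act.IsAdmissibleLaw P σ) (z : Fin d → ℝ) (hab : a ≤ b)
    (hbL : b ≤ L) :
    CondExpLE P a
      (fun W : Weights L d => ENNReal.ofReal (frobNorm (chain (gates act W z) W a b) ^ 2))
      (ENNReal.ofReal (d * lam act d σ ^ (b - a))) := by
  simpa only [Fintype.card_fin] using
    CondExpLE.frobNorm_sq (measurable_chain_apply act measurable_id' measurable_const a b)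
      fun u => condExpLE_chain_mulVec hP z u hab hbL

theorem condExpLE_mulVec_linear_chain (hP : IsCenteredLaw P σ) {ι : Type*} [Fintype ι]
    (B : Matrix ι (Fin d) ℝ) (z u : Fin d → ℝ) (hab : a ≤ b) (hbL : b < L) :
    CondExpLE P a
      (fun W : Weights L d => ENNReal.ofReal
        (euclNorm (B *ᵥ (chain (gates .linear W z) W a (b + 1) *ᵥ u)) ^ 2))
      (ENNReal.ofReal (σ ^ 2 * frobNorm B ^ 2 * lam .linear d σ ^ (b - a) * euclNorm u ^ 2)) := by
  have := hP.isProbabilityMeasure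
  have hadm : Activation.linear.IsAdmissibleLaw P σ := ⟨hP, nofun⟩
  have hout : Measurable fun W : Weights L d =>
      B *ᵥ (chain (gates .linear W z) W a (b + 1) *ᵥ u) :=
    measurable_mulVec (fun _ _ => measurable_const)
      (measurable_chain_mulVec .linear measurable_id' measurable_const a (b + 1) measurable_const)
  have hstep := CondExpLE.of_update (b := ⟨b, hbL⟩)
    (K := ENNReal.ofReal (σ ^ 2 * frobNorm B ^ 2)) (condExpLE_chain_mulVec hadm z u hab hbL.le) hab
    (measurable_ofReal_chain_mulVec_sq .linear z u a b) (measurable_ofReal_euclNorm_sq hout)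
    fun W => ?_
  · rwa [← ENNReal.ofReal_mul (by positivity), ← mul_assoc] at hstep
  · simp only [chain_update_mulVec .linear W (b := ⟨b, hbL⟩) hab, Activation.gate, one_mul]
    rw [← ENNReal.ofReal_mul (by positivity)]
    exact (hP.lintegral_mulVec_mulVec_sq B _).le

-- The gates of the last ReLU layer depend on its weights, so the cross terms of `B D^L W^L` do not
-- average out; estimating `‖B M‖ ≤ ‖B‖ ‖M‖` instead costs the factor `d`.
theorem condExpLE_mul_chain (hP : act.IsAdmissibleLaw P σ) {ι : Type*} [Fintype ι]
    (B : Matrix ι (Fin d) ℝ) (z : Fin d → ℝ) (haL : a ≤ L) :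
    CondExpLE P a
      (fun W : Weights L d => ENNReal.ofReal (frobNorm (B * chain (gates act W z) W a L) ^ 2))
      (ENNReal.ofReal (act.widthFactor d * frobNorm B ^ 2 * lam act d σ ^ (L - a))) := by
  cases act with
  | relu =>
    have h := (condExpLE_chain hP z haL le_rfl).const_mul
      (measurable_ofReal_chain_sq .relu z a L) (ENNReal.ofReal (frobNorm B ^ 2))
    rw [← ENNReal.ofReal_mul (sq_nonneg _), mul_left_comm, ← mul_assoc] at h
    refine h.mono fun W => ?_
    rw [← ENNReal.ofReal_mul (sq_nonneg _), ← mul_pow]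
    have := frobNorm_nonneg (B * chain (gates .relu W z) W a L)
    gcongr
    exact frobNorm_mul_le _ _
  | linear =>
    simp only [Activation.widthFactor, one_mul]
    rcases haL.eq_or_lt with rfl | hlt
    · refine CondExpLE.of_forall_le fun W => ?_
      have hgates : gates .linear W z a = 1 := rfl
      rw [chain_self, hgates, Nat.sub_self, pow_zero, mul_one, Matrix.diagonal_one',
        Matrix.mul_one]
    · obtain ⟨b, rfl⟩ := Nat.exists_eq_add_one_of_ne_zero (Nat.ne_zero_of_lt hlt)
      have hmeas : ∀ i j, Measurable fun W : Weights (b + 1) d =>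
          (B * chain (gates .linear W z) W a (b + 1)) i j :=
        measurable_mul_apply (fun _ _ => measurable_const)
          (measurable_chain_apply .linear measurable_id' measurable_const a (b + 1))
      have h := CondExpLE.frobNorm_sq hmeas fun u => by
        simpa only [Matrix.mulVec_mulVec] using
          condExpLE_mulVec_linear_chain hP.toIsCenteredLaw B z u (Nat.le_of_lt_succ hlt)
            b.lt_succ_self
      convert h using 2
      rw [Nat.sub_add_comm (Nat.le_of_lt_succ hlt), pow_succ']
      simp only [lam, Activation.p, Fintype.card_fin]
      ring

end ChainMoments

section JacobianMoments

variable {L d : ℕ} {P : Measure ℝ} {σ : ℝ} {act : Activation} {a b m : ℕ}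

theorem dependsOn_ofReal_chain_mulVec_sq (act : Activation) (z u : Fin d → ℝ) (hbm : b ≤ m) :
    DependsOn (fun W : Weights L d =>
      ENNReal.ofReal (euclNorm (chain (gates act W z) W a b *ᵥ u) ^ 2)) {j | (j : ℕ) < m} :=
  fun _ _ h => congrArg (fun M => ENNReal.ofReal (euclNorm (M *ᵥ u) ^ 2))
    (dependsOn_chain act z a b fun j (hj : (j : ℕ) < b) => h j (hj.trans_le hbm))

theorem dependsOn_ofReal_chain_sq (act : Activation) (z : Fin d → ℝ) (hbm : b ≤ m) :
    DependsOn (fun W : Weights L d =>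
      ENNReal.ofReal (frobNorm (chain (gates act W z) W a b) ^ 2)) {j | (j : ℕ) < m} :=
  fun _ _ h => congrArg (fun M => ENNReal.ofReal (frobNorm M ^ 2))
    (dependsOn_chain act z a b fun j (hj : (j : ℕ) < b) => h j (hj.trans_le hbm))

variable {dOut : ℕ} {B : Matrix (Fin dOut) (Fin d) ℝ} {K : ℝ}

theorem lintegral_netOut_sq_le (hP : act.IsAdmissibleLaw P σ) (B : Matrix (Fin dOut) (Fin d) ℝ)
    (z : Fin d → ℝ) :
    ∫⁻ W, ENNReal.ofReal (euclNorm (netOut B (gates act W z) z W) ^ 2) ∂(initLaw P L d) ≤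
      ENNReal.ofReal (frobNorm B ^ 2 * lam act d σ ^ L * euclNorm z ^ 2) := by
  have := hP.isProbabilityMeasure
  have h := (condExpLE_chain_mulVec hP z z L.zero_le le_rfl).const_mul
    (measurable_ofReal_chain_mulVec_sq act z z 0 L) (ENNReal.ofReal (frobNorm B ^ 2))
  rw [← ENNReal.ofReal_mul (sq_nonneg _), Nat.sub_zero, ← mul_assoc] at h
  refine (h.mono fun W => ?_).lintegral_le
  rw [← ENNReal.ofReal_mul (sq_nonneg _), ← mul_pow]
  have := euclNorm_nonneg (netOut B (gates act W z) z W)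
  gcongr
  exact euclNorm_mulVec_le _ _

theorem lintegral_jac_sq_le (hP : act.IsAdmissibleLaw P σ) (z : Fin d → ℝ) (k : Fin L)
    (hK : 0 ≤ K)
    (hB : ∀ a ≤ L, CondExpLE P a
      (fun W : Weights L d => ENNReal.ofReal (frobNorm (B * chain (gates act W z) W a L) ^ 2))
      (ENNReal.ofReal (K * lam act d σ ^ (L - a)))) :
    ∫⁻ W, ENNReal.ofReal (frobNorm (jac B (gates act W z) z W k) ^ 2) ∂(initLaw P L d) ≤
      ENNReal.ofReal (K * lam act d σ ^ (L - 1) * euclNorm z ^ 2) := by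
  have := hP.isProbabilityMeasure
  have hlam := lam_nonneg act d σ
  have hin := condExpLE_chain_mulVec (L := L) hP z z (Nat.zero_le k) k.2.le
  have hmeas := measurable_ofReal_chain_mulVec_sq (L := L) act z z 0 k
  have h := ((hB (k + 1) k.2).mul hin (Nat.zero_le _) hmeas
    (dependsOn_ofReal_chain_mulVec_sq act z z k.1.le_succ)).lintegral_le
  have hexp : L - (k + 1) + (k - 0) = L - 1 := by omega
  rw [← ENNReal.ofReal_mul (by positivity), mul_assoc, ← mul_assoc (_ ^ _), ← pow_add, hexp,
    ← mul_assoc] at h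
  simpa only [← ENNReal.ofReal_mul (sq_nonneg _), ← mul_pow, ← frobNorm_jac] using h

theorem lintegral_jac₂_sq_le (hP : act.IsAdmissibleLaw P σ) (z : Fin d → ℝ) {k l : Fin L}
    (hkl : k < l) (hK : 0 ≤ K)
    (hB : ∀ a ≤ L, CondExpLE P a
      (fun W : Weights L d => ENNReal.ofReal (frobNorm (B * chain (gates act W z) W a L) ^ 2))
      (ENNReal.ofReal (K * lam act d σ ^ (L - a)))) :
    ∫⁻ W, ENNReal.ofReal (frobNorm (jac₂ B (gates act W z) z W k l) ^ 2) ∂(initLaw P L d) ≤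
      ENNReal.ofReal (K * d * lam act d σ ^ (L - 2) * euclNorm z ^ 2) := by
  have := hP.isProbabilityMeasure
  have hlam := lam_nonneg act d σ
  have hin := condExpLE_chain_mulVec (L := L) hP z z (Nat.zero_le k) k.2.le
  have hmeas := measurable_ofReal_chain_mulVec_sq (L := L) act z z 0 k
  have hmid := (condExpLE_chain (L := L) hP z hkl l.2.le).mul hin (Nat.zero_le _) hmeas
    (dependsOn_ofReal_chain_mulVec_sq act z z k.1.le_succ)
  have hdep : DependsOn (fun W : Weights L d =>
      ENNReal.ofReal (frobNorm (chain (gates act W z) W (k + 1) l) ^ 2) *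
        ENNReal.ofReal (euclNorm (chain (gates act W z) W 0 k *ᵥ z) ^ 2)) {j | (j : ℕ) < l + 1} :=
    fun _ _ h => congrArg₂ (· * ·) (dependsOn_ofReal_chain_sq act z l.1.le_succ h)
      (dependsOn_ofReal_chain_mulVec_sq act z z (Nat.le_succ_of_le hkl.le) h)
  have h := ((hB (l + 1) l.2).mul hmid (Nat.zero_le _)
    ((measurable_ofReal_chain_sq act z _ _).mul hmeas) hdep).lintegral_le
  have hexp : L - (l + 1) + (l - (k + 1)) + (k - 0) = L - 2 := by
    have : (k : ℕ) < l := hkl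
    omega
  rw [← ENNReal.ofReal_mul (by positivity), ← ENNReal.ofReal_mul (by positivity)] at h
  have hK' : K * lam act d σ ^ (L - (l + 1)) *
      (d * lam act d σ ^ ((l : ℕ) - (k + 1)) * (lam act d σ ^ ((k : ℕ) - 0) * euclNorm z ^ 2)) =
      K * d * lam act d σ ^ (L - 2) * euclNorm z ^ 2 := by
    rw [← hexp, pow_add, pow_add]
    ring
  rw [hK'] at h
  simpa only [← ENNReal.ofReal_mul (sq_nonneg _), ← mul_pow, ← frobNorm_jac₂] using h

end JacobianMoments

section JointLaw

variable {L d dIn dOut : ℕ} {P : Measure ℝ} {σ : ℝ} {act : Activation}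

instance isProbabilityMeasure_jointLaw [IsProbabilityMeasure P] :
    IsProbabilityMeasure (jointLaw P dIn dOut d L) := by
  unfold jointLaw
  infer_instance

theorem measurable_of_apply {Ω ι κ : Type*} [MeasurableSpace Ω] {M : Ω → ι → κ → ℝ}
    (hM : Measurable M) (i : ι) (j : κ) : Measurable fun θ => Matrix.of (M θ) i j :=
  hM.eval.eval

theorem IsCenteredLaw.lintegral_prod_mul_sq {Ω ι κ τ : Type*} [MeasurableSpace Ω] [Fintype ι]
    [Fintype κ] [Fintype τ] (hP : IsCenteredLaw P σ) (ν : Measure Ω) [SFinite ν]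
    {N : Ω → Matrix κ τ ℝ} (hN : ∀ i j, Measurable fun ω => N ω i j) :
    ∫⁻ q, ENNReal.ofReal (frobNorm (Matrix.of q.1 * N q.2) ^ 2) ∂((matLaw P ι κ).prod ν) =
      ENNReal.ofReal (Fintype.card ι * σ ^ 2) *
        ∫⁻ ω, ENNReal.ofReal (frobNorm (N ω) ^ 2) ∂ν := by
  have := hP.isProbabilityMeasure
  have hmeas : Measurable fun q : (ι → κ → ℝ) × Ω =>
      ENNReal.ofReal (frobNorm (Matrix.of q.1 * N q.2) ^ 2) :=
    measurable_ofReal_frobNorm_sq <| measurable_mul_apply (measurable_of_apply measurable_fst)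
      fun i j => (hN i j).comp measurable_snd
  refine (lintegral_prod_symm _ hmeas.aemeasurable).trans ?_
  simp only [hP.lintegral_frobNorm_mul_sq,
    ENNReal.ofReal_mul (show 0 ≤ (Fintype.card ι : ℝ) * σ ^ 2 by positivity)]
  exact lintegral_const_mul _ (measurable_ofReal_frobNorm_sq hN)

theorem IsCenteredLaw.lintegral_jointLaw_mul_sq_le (hP : IsCenteredLaw P σ) {κ : Type*} [Fintype κ]
    {N : (Fin d → ℝ) → Weights L d → Matrix (Fin d) κ ℝ} {K : ℝ} (hK : 0 ≤ K)
    (hN : ∀ i j, Measurable fun q : (Fin d → ℝ) × Weights L d => N q.1 q.2 i j)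
    (hNK : ∀ z, ∫⁻ W, ENNReal.ofReal (frobNorm (N z W) ^ 2) ∂(initLaw P L d) ≤
      ENNReal.ofReal (K * euclNorm z ^ 2)) (v : Fin dIn → ℝ) :
    ∫⁻ θ, ENNReal.ofReal (frobNorm (Matrix.of θ.2.1 * N (Matrix.of θ.1 *ᵥ v) θ.2.2) ^ 2)
        ∂(jointLaw P dIn dOut d L) ≤
      ENNReal.ofReal (dOut * σ ^ 2 * K * (d * σ ^ 2 * euclNorm v ^ 2)) := by
  have := hP.isProbabilityMeasure
  have hmeas : Measurable fun θ : (Fin d → Fin dIn → ℝ) × (Fin dOut → Fin d → ℝ) × Weights L d =>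
      ENNReal.ofReal (frobNorm (Matrix.of θ.2.1 * N (Matrix.of θ.1 *ᵥ v) θ.2.2) ^ 2) :=
    measurable_ofReal_frobNorm_sq <| measurable_mul_apply
      (measurable_of_apply (measurable_fst.comp measurable_snd)) fun i j => (hN i j).comp
        (((measurable_of_mulVec v).comp measurable_fst).prodMk (measurable_snd.comp measurable_snd))
  have houtHidden (A : Fin d → Fin dIn → ℝ) :
      ∫⁻ q, ENNReal.ofReal (frobNorm (Matrix.of q.1 * N (Matrix.of A *ᵥ v) q.2) ^ 2)
          ∂((matLaw P (Fin dOut) (Fin d)).prod (initLaw P L d)) ≤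
        ENNReal.ofReal (dOut * σ ^ 2 * K) *
          ENNReal.ofReal (euclNorm (Matrix.of A *ᵥ v) ^ 2) := by
    rw [hP.lintegral_prod_mul_sq (initLaw P L d) (N := N (Matrix.of A *ᵥ v))
      fun i j => (hN i j).comp measurable_prodMk_left,
      Fintype.card_fin, ENNReal.ofReal_mul (p := dOut * σ ^ 2) (by positivity), mul_assoc,
      ← ENNReal.ofReal_mul hK]
    exact mul_le_mul_right (hNK _) _
  refine (lintegral_prod _ hmeas.aemeasurable).trans_le ?_
  refine (lintegral_mono houtHidden).trans_eq ?_
  rw [lintegral_const_mul _ (measurable_ofReal_euclNorm_sq (measurable_of_mulVec v)),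
    ENNReal.ofReal_mul (p := dOut * σ ^ 2 * K) (by positivity)]
  congr 1
  simpa only [Fintype.card_fin] using hP.lintegral_mulVec_sq (ι := Fin d) v

theorem measurable_smul_apply {Ω ι κ : Type*} [MeasurableSpace Ω] {c : Ω → ℝ}
    {M : Ω → Matrix ι κ ℝ} (hc : Measurable c) (hM : ∀ i j, Measurable fun θ => M θ i j)
    (i : ι) (j : κ) : Measurable fun θ => (c θ • M θ) i j :=
  hc.mul (hM i j)

open scoped Matrix.Norms.Frobenius in
theorem frobNorm_smul_of_nonneg {ι κ : Type*} [Fintype ι] [Fintype κ] (M : Matrix ι κ ℝ) {c : ℝ}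
    (hc : 0 ≤ c) : frobNorm (c • M) = frobNorm M * c := by
  rw [frobNorm_eq_norm, frobNorm_eq_norm, norm_smul, Real.norm_of_nonneg hc, mul_comm]

theorem lintegral_jointLaw_netOut_sq_le (hP : act.IsAdmissibleLaw P σ) (v : Fin dIn → ℝ) :
    ∫⁻ θ, ENNReal.ofReal (euclNorm (netOut (Matrix.of θ.2.1)
        (gates act θ.2.2 (Matrix.of θ.1 *ᵥ v)) (Matrix.of θ.1 *ᵥ v) θ.2.2) ^ 2)
        ∂(jointLaw P dIn dOut d L) ≤
      ENNReal.ofReal (dOut * σ ^ 2 * lam act d σ ^ L * (d * σ ^ 2 * euclNorm v ^ 2)) := by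
  have := hP.isProbabilityMeasure
  have hcol (B : Matrix (Fin dOut) (Fin d) ℝ) (u : Fin d → ℝ) :
      euclNorm (B *ᵥ u) = frobNorm (B * Matrix.replicateCol Unit u) := by
    rw [← Matrix.replicateCol_mulVec, frobNorm_replicateCol]
  simp only [netOut, hcol]
  refine hP.lintegral_jointLaw_mul_sq_le
    (N := fun z W => Matrix.replicateCol Unit (chain (gates act W z) W 0 L *ᵥ z))
    (pow_nonneg (lam_nonneg act d σ) L) (fun i _ => ?_) (fun z => ?_) v
  · exact (measurable_chain_mulVec act measurable_snd measurable_fst 0 L measurable_fst).eval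
  · simp only [frobNorm_replicateCol]
    exact (condExpLE_chain_mulVec hP z z L.zero_le le_rfl).lintegral_le

theorem condExpLE_one_mul_chain (hP : act.IsAdmissibleLaw P σ) (z : Fin d → ℝ) (a : ℕ)
    (ha : a ≤ L) :
    CondExpLE P a
      (fun W : Weights L d => ENNReal.ofReal
        (frobNorm ((1 : Matrix (Fin d) (Fin d) ℝ) * chain (gates act W z) W a L) ^ 2))
      (ENNReal.ofReal (d * lam act d σ ^ (L - a))) := by
  simpa only [Matrix.one_mul] using condExpLE_chain hP z ha le_rfl

theorem lintegral_jointLaw_jac_sq_le (hP : act.IsAdmissibleLaw P σ) (v : Fin dIn → ℝ)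
    (k : Fin L) :
    ∫⁻ θ, ENNReal.ofReal (frobNorm (jac (Matrix.of θ.2.1)
        (gates act θ.2.2 (Matrix.of θ.1 *ᵥ v)) (Matrix.of θ.1 *ᵥ v) θ.2.2 k) ^ 2)
        ∂(jointLaw P dIn dOut d L) ≤
      ENNReal.ofReal
        (dOut * σ ^ 2 * (d * lam act d σ ^ (L - 1)) * (d * σ ^ 2 * euclNorm v ^ 2)) := by
  have := hP.isProbabilityMeasure
  have hlam := lam_nonneg act d σ
  simp only [frobNorm_jac, ← frobNorm_smul_of_nonneg _ (euclNorm_nonneg _), ← Matrix.mul_smul]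
  refine hP.lintegral_jointLaw_mul_sq_le
    (N := fun z W => euclNorm (chain (gates act W z) W 0 k *ᵥ z) •
      chain (gates act W z) W (k + 1) L) (by positivity) ?_ (fun z => ?_) v
  · exact measurable_smul_apply (measurable_euclNorm.comp
      (measurable_chain_mulVec act measurable_snd measurable_fst _ _ measurable_fst))
      (measurable_chain_apply act measurable_snd measurable_fst _ _)
  · have h := lintegral_jac_sq_le hP z k (Nat.cast_nonneg d) (condExpLE_one_mul_chain hP z)
    simpa only [frobNorm_jac, Matrix.one_mul, frobNorm_smul_of_nonneg _ (euclNorm_nonneg _)] using h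

theorem lintegral_jointLaw_jac₂_sq_le (hP : act.IsAdmissibleLaw P σ) (v : Fin dIn → ℝ)
    {k l : Fin L} (hkl : k < l) :
    ∫⁻ θ, ENNReal.ofReal (frobNorm (jac₂ (Matrix.of θ.2.1)
        (gates act θ.2.2 (Matrix.of θ.1 *ᵥ v)) (Matrix.of θ.1 *ᵥ v) θ.2.2 k l) ^ 2)
        ∂(jointLaw P dIn dOut d L) ≤
      ENNReal.ofReal
        (dOut * σ ^ 2 * (d * d * lam act d σ ^ (L - 2)) * (d * σ ^ 2 * euclNorm v ^ 2)) := by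
  have := hP.isProbabilityMeasure
  have hlam := lam_nonneg act d σ
  have hfactor (W : Weights L d) (z : Fin d → ℝ) :
      0 ≤ frobNorm (chain (gates act W z) W (k + 1) l) *
        euclNorm (chain (gates act W z) W 0 k *ᵥ z) :=
    mul_nonneg (frobNorm_nonneg _) (euclNorm_nonneg _)
  simp only [frobNorm_jac₂, ← frobNorm_smul_of_nonneg _ (hfactor _ _), ← Matrix.mul_smul]
  refine hP.lintegral_jointLaw_mul_sq_le
    (N := fun z W => (frobNorm (chain (gates act W z) W (k + 1) l) *
      euclNorm (chain (gates act W z) W 0 k *ᵥ z)) • chain (gates act W z) W (l + 1) L)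
    (by positivity) ?_ (fun z => ?_) v
  · have hW : Measurable fun q : (Fin d → ℝ) × Weights L d => q.2 := measurable_snd
    have hz : Measurable fun q : (Fin d → ℝ) × Weights L d => q.1 := measurable_fst
    exact measurable_smul_apply
      ((measurable_frobNorm (measurable_chain_apply act hW hz _ _)).mul
        (measurable_euclNorm.comp (measurable_chain_mulVec act hW hz _ _ hz)))
      (measurable_chain_apply act hW hz _ _)
  · have h := lintegral_jac₂_sq_le hP z hkl (Nat.cast_nonneg d) (condExpLE_one_mul_chain hP z)
    simpa only [frobNorm_jac₂, Matrix.one_mul, frobNorm_smul_of_nonneg _ (hfactor _ _)] using h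

end JointLaw

section SecondMoments

variable {Ω : Type*} [MeasurableSpace Ω] {μ : Measure Ω} {f g : Ω → ℝ} {a b c S : ℝ}

theorem eLpNorm_two_le_of_lintegral_sq_le (ha : 0 ≤ a)
    (h : ∫⁻ ω, ENNReal.ofReal (f ω ^ 2) ∂μ ≤ ENNReal.ofReal (a ^ 2)) :
    eLpNorm f 2 μ ≤ ENNReal.ofReal a := by
  have hsq : eLpNorm f 2 μ ^ (2 : ℝ) = ∫⁻ ω, ENNReal.ofReal (f ω ^ 2) ∂μ := by
    refine (eLpNorm_nnreal_pow_eq_lintegral (p := 2) two_ne_zero).trans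
      (lintegral_congr fun ω => ?_)
    rw [← sq_abs, ENNReal.ofReal_pow (abs_nonneg _), Real.enorm_eq_ofReal_abs]
    exact ENNReal.rpow_two _
  rw [← ENNReal.rpow_le_rpow_iff two_pos, hsq, ENNReal.rpow_two, ← ENNReal.ofReal_pow ha]
  exact h

theorem eLpNorm_one_mul_le (hf : Measurable f) (hg : Measurable g) (ha : 0 ≤ a)
    (hfa : eLpNorm f 2 μ ≤ ENNReal.ofReal a) (hgb : eLpNorm g 2 μ ≤ ENNReal.ofReal b) :
    eLpNorm (fun ω => f ω * g ω) 1 μ ≤ ENNReal.ofReal (a * b) := by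
  rw [ENNReal.ofReal_mul ha]
  exact (eLpNorm_smul_le_mul_eLpNorm hg.aestronglyMeasurable hf.aestronglyMeasurable).trans
    (mul_le_mul' hfa hgb)

theorem eLpNorm_two_add_const_le [IsProbabilityMeasure μ] (hf : Measurable f) (ha : 0 ≤ a)
    (hc : 0 ≤ c) (hcS : c ≤ S) (hfa : eLpNorm f 2 μ ≤ ENNReal.ofReal a) :
    eLpNorm (fun ω => f ω + c) 2 μ ≤ ENNReal.ofReal (a + S) := by
  rw [ENNReal.ofReal_add ha (hc.trans hcS)]
  refine (eLpNorm_add_le hf.aestronglyMeasurable aestronglyMeasurable_const one_le_two).trans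
    (add_le_add hfa ?_)
  rw [eLpNorm_const c two_ne_zero (IsProbabilityMeasure.ne_zero μ), measure_univ, ENNReal.one_rpow,
    mul_one, Real.enorm_of_nonneg hc]
  exact ENNReal.ofReal_le_ofReal hcS

theorem eLpNorm_one_mean_le {n : ℕ} {Y : Fin n → Ω → ℝ} (hY : ∀ s, Measurable (Y s))
    (hYa : ∀ s, eLpNorm (Y s) 1 μ ≤ ENNReal.ofReal a) :
    eLpNorm (fun ω => 1 / (n : ℝ) * ∑ s, Y s ω) 1 μ ≤ ENNReal.ofReal a := by
  have hsum : (fun ω => 1 / (n : ℝ) * ∑ s, Y s ω) = (1 / (n : ℝ)) • ∑ s, Y s := by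
    ext ω
    simp only [Pi.smul_apply, Finset.sum_apply, smul_eq_mul]
  rw [hsum, eLpNorm_const_smul, Real.enorm_of_nonneg (by positivity)]
  rcases n.eq_zero_or_pos with rfl | hn
  · simp
  calc ENNReal.ofReal (1 / n) * eLpNorm (∑ s, Y s) 1 μ
      ≤ ENNReal.ofReal (1 / n) * ∑ _s : Fin n, ENNReal.ofReal a := by
        gcongr
        exact (eLpNorm_sum_le (fun s _ => (hY s).aestronglyMeasurable) le_rfl).trans
          (Finset.sum_le_sum fun s _ => hYa s)
    _ = ENNReal.ofReal a := by
        have hn0 : (n : ℝ) ≠ 0 := Nat.cast_ne_zero.mpr hn.ne'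
        rw [Finset.sum_const, Finset.card_univ, Fintype.card_fin, nsmul_eq_mul, ← mul_assoc,
          ← ENNReal.ofReal_natCast n, ← ENNReal.ofReal_mul (by positivity), one_div_mul_cancel hn0,
          ENNReal.ofReal_one, one_mul]

theorem integrable_and_integral_le_of_le_mean {n : ℕ} {X : Ω → ℝ} {Y : Fin n → Ω → ℝ}
    (hX : Measurable X) (hX0 : ∀ ω, 0 ≤ X ω) (hY : ∀ s, Measurable (Y s))
    (hXY : ∀ ω, X ω ≤ 1 / (n : ℝ) * ∑ s, Y s ω) (ha : 0 ≤ a)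
    (hYa : ∀ s, eLpNorm (Y s) 1 μ ≤ ENNReal.ofReal a) :
    Integrable X μ ∧ ∫ ω, X ω ∂μ ≤ a := by
  have hle : eLpNorm X 1 μ ≤ ENNReal.ofReal a :=
    (eLpNorm_mono_real fun ω => (Real.norm_of_nonneg (hX0 ω)).trans_le (hXY ω)).trans
      (eLpNorm_one_mean_le hY hYa)
  have hint : Integrable X μ :=
    memLp_one_iff_integrable.mp ⟨hX.aestronglyMeasurable, hle.trans_lt ENNReal.ofReal_lt_top⟩
  refine ⟨hint, (ENNReal.ofReal_le_ofReal_iff ha).mp ?_⟩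
  rwa [ofReal_integral_eq_lintegral_ofReal hint (ae_of_all _ hX0),
    ← lintegral_congr fun ω => Real.enorm_of_nonneg (hX0 ω), ← eLpNorm_one_eq_lintegral_enorm]

end SecondMoments

section Expectations

variable {L d dIn dOut n : ℕ} {Ω : Type*} [MeasurableSpace Ω]

/-- A random network, with weights `W`, input matrix `A` and output matrix `B`, whose output has
`L²` norm at most `c * e₀`, and whose output has first derivatives of `L²` norm at most `c * e₁` and
mixed second derivatives of `L²` norm at most `c * e₂`, at each of the samples `x`. The common
factor `c` carries the dependence on everything but the depth, the width and `lam`. -/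
structure HasMomentBounds (act : Activation) (μ : Measure Ω) (A : Ω → Matrix (Fin d) (Fin dIn) ℝ)
    (B : Ω → Matrix (Fin dOut) (Fin d) ℝ) (W : Ω → Weights L d) (x : Fin n → Fin dIn → ℝ)
    (c e₀ e₁ e₂ : ℝ) : Prop where
  measurable_input : ∀ i j, Measurable fun θ => A θ i j
  measurable_output : ∀ o i, Measurable fun θ => B θ o i
  measurable_weights : Measurable W
  nonneg : 0 ≤ c
  nonneg₀ : 0 ≤ e₀
  nonneg₁ : 0 ≤ e₁
  nonneg₂ : 0 ≤ e₂
  netOut_le : ∀ s, eLpNorm (fun θ => euclNorm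
    (netOut (B θ) (gates act (W θ) (A θ *ᵥ x s)) (A θ *ᵥ x s) (W θ))) 2 μ ≤ ENNReal.ofReal (c * e₀)
  jac_le : ∀ s (k : Fin L), eLpNorm (fun θ => frobNorm
    (jac (B θ) (gates act (W θ) (A θ *ᵥ x s)) (A θ *ᵥ x s) (W θ) k)) 2 μ ≤ ENNReal.ofReal (c * e₁)
  jac₂_le : ∀ s (k l : Fin L), k < l → eLpNorm (fun θ => frobNorm
    (jac₂ (B θ) (gates act (W θ) (A θ *ᵥ x s)) (A θ *ᵥ x s) (W θ) k l)) 2 μ ≤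
      ENNReal.ofReal (c * e₂)

namespace HasMomentBounds

variable {act : Activation} {μ : Measure Ω} {A : Ω → Matrix (Fin d) (Fin dIn) ℝ}
  {B : Ω → Matrix (Fin dOut) (Fin d) ℝ} {W : Ω → Weights L d} {x : Fin n → Fin dIn → ℝ}
  {y : Fin n → Fin dOut → ℝ} {c e₀ e₁ e₂ R : ℝ}

theorem measurable_norm_jac (h : HasMomentBounds act μ A B W x c e₀ e₁ e₂) (s : Fin n) (k : Fin L) :
    Measurable fun θ => frobNorm
      (jac (B θ) (gates act (W θ) (A θ *ᵥ x s)) (A θ *ᵥ x s) (W θ) k) :=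
  measurable_frobNorm (measurable_jac_apply act h.measurable_weights h.measurable_output
    (measurable_mulVec h.measurable_input measurable_const) k)

theorem measurable_norm_jac₂ (h : HasMomentBounds act μ A B W x c e₀ e₁ e₂) (s : Fin n)
    (k l : Fin L) :
    Measurable fun θ => frobNorm
      (jac₂ (B θ) (gates act (W θ) (A θ *ᵥ x s)) (A θ *ᵥ x s) (W θ) k l) :=
  measurable_frobNorm (measurable_jac₂_apply act h.measurable_weights h.measurable_output
    (measurable_mulVec h.measurable_input measurable_const) k l)

theorem measurable_norm_netOut (h : HasMomentBounds act μ A B W x c e₀ e₁ e₂) (s : Fin n) :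
    Measurable fun θ => euclNorm
      (netOut (B θ) (gates act (W θ) (A θ *ᵥ x s)) (A θ *ᵥ x s) (W θ)) :=
  measurable_euclNorm.comp (measurable_netOut act h.measurable_weights h.measurable_output
    (measurable_mulVec h.measurable_input measurable_const))

theorem residual_le [IsProbabilityMeasure μ] (h : HasMomentBounds act μ A B W x c e₀ e₁ e₂)
    (hy : ∀ s, euclNorm (y s) ≤ R) (s : Fin n) :
    eLpNorm (fun θ => euclNorm (netOut (B θ) (gates act (W θ) (A θ *ᵥ x s)) (A θ *ᵥ x s) (W θ)) +
      euclNorm (y s)) 2 μ ≤ ENNReal.ofReal (c * e₀ + R) :=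
  eLpNorm_two_add_const_le (h.measurable_norm_netOut s) (mul_nonneg h.nonneg h.nonneg₀)
    (euclNorm_nonneg _) (hy s) (h.netOut_le s)

theorem integral_gradNorm_le [IsProbabilityMeasure μ] (h : HasMomentBounds act μ A B W x c e₀ e₁ e₂)
    (hR : 0 ≤ R) (hy : ∀ s, euclNorm (y s) ≤ R) (k : Fin L) :
    Integrable (fun θ => gradNorm act (A θ) (B θ) x y (W θ) k) μ ∧
      ∫ θ, gradNorm act (A θ) (B θ) x y (W θ) k ∂μ ≤ (c ^ 2 + c * R) * (e₁ + e₀ * e₁) := by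
  obtain ⟨hc, h₀, h₁⟩ := And.intro h.nonneg (And.intro h.nonneg₀ h.nonneg₁)
  have hle : (c * e₀ + R) * (c * e₁) ≤ (c ^ 2 + c * R) * (e₁ + e₀ * e₁) := by
    linear_combination (by positivity : 0 ≤ c ^ 2 * e₁ + c * R * (e₀ * e₁))
  refine (integrable_and_integral_le_of_le_mean
    (measurable_gradNorm act h.measurable_weights h.measurable_output h.measurable_input x y k)
    (fun _ => frobNorm_nonneg _)
    (fun s => ((h.measurable_norm_netOut s).add_const _).mul (h.measurable_norm_jac s k))
    (fun θ => gradNorm_le act _ _ x y _ k) (by positivity) fun s => ?_).imp_right hle.trans'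
  exact eLpNorm_one_mul_le ((h.measurable_norm_netOut s).add_const _) (h.measurable_norm_jac s k)
    (by positivity) (h.residual_le hy s) (h.jac_le s k)

theorem integral_hessNorm_self_le (h : HasMomentBounds act μ A B W x c e₀ e₁ e₂) (hR : 0 ≤ R)
    (k : Fin L) :
    Integrable (fun θ => hessNorm act (A θ) (B θ) x y (W θ) k k) μ ∧
      ∫ θ, hessNorm act (A θ) (B θ) x y (W θ) k k ∂μ ≤ (c ^ 2 + c * R) * (e₁ * e₁) := by
  obtain ⟨hc, h₁⟩ := And.intro h.nonneg h.nonneg₁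
  have hle : c * e₁ * (c * e₁) ≤ (c ^ 2 + c * R) * (e₁ * e₁) := by
    linear_combination (by positivity : 0 ≤ c * R * (e₁ * e₁))
  refine (integrable_and_integral_le_of_le_mean
    (measurable_hessNorm act h.measurable_weights h.measurable_output h.measurable_input x y k k)
    (fun _ => frobNorm_nonneg _)
    (fun s => (h.measurable_norm_jac s k).mul (h.measurable_norm_jac s k))
    (fun θ => hessNorm_self_le act _ _ x y _ k) (by positivity) fun s => ?_).imp_right
      hle.trans'
  exact eLpNorm_one_mul_le (h.measurable_norm_jac s k) (h.measurable_norm_jac s k) (by positivity)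
    (h.jac_le s k) (h.jac_le s k)

theorem integral_hessNorm_le [IsProbabilityMeasure μ] (h : HasMomentBounds act μ A B W x c e₀ e₁ e₂)
    (hR : 0 ≤ R) (hy : ∀ s, euclNorm (y s) ≤ R) {k l : Fin L} (hkl : k ≠ l) :
    Integrable (fun θ => hessNorm act (A θ) (B θ) x y (W θ) k l) μ ∧
      ∫ θ, hessNorm act (A θ) (B θ) x y (W θ) k l ∂μ ≤
        (c ^ 2 + c * R) * (e₂ + e₁ * e₁ + e₀ * e₂) := by
  wlog hlt : k < l generalizing k l
  · simp only [hessNorm_comm act _ _ x y _ k l]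
    exact this hkl.symm (hkl.lt_or_gt.resolve_left hlt)
  obtain ⟨hc, h₀, h₁, h₂⟩ :=
    And.intro h.nonneg (And.intro h.nonneg₀ (And.intro h.nonneg₁ h.nonneg₂))
  have hfirst (s : Fin n) := (h.measurable_norm_jac s k).mul (h.measurable_norm_jac s l)
  have hsecond (s : Fin n) :=
    ((h.measurable_norm_netOut s).add_const (euclNorm (y s))).mul (h.measurable_norm_jac₂ s k l)
  have hle : c * e₁ * (c * e₁) + (c * e₀ + R) * (c * e₂) ≤
      (c ^ 2 + c * R) * (e₂ + e₁ * e₁ + e₀ * e₂) := by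
    linear_combination (by positivity : 0 ≤ c ^ 2 * e₂ + c * R * (e₁ * e₁ + e₀ * e₂))
  refine (integrable_and_integral_le_of_le_mean
    (measurable_hessNorm act h.measurable_weights h.measurable_output h.measurable_input x y k l)
    (fun _ => frobNorm_nonneg _) (fun s => (hfirst s).add (hsecond s))
    (fun θ => hessNorm_le_of_lt act _ _ x y _ hlt) (by positivity) fun s => ?_).imp_right hle.trans'
  rw [ENNReal.ofReal_add (by positivity) (by positivity)]
  exact (eLpNorm_add_le (hfirst s).aestronglyMeasurable (hsecond s).aestronglyMeasurable
    le_rfl).trans <| add_le_add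
      (eLpNorm_one_mul_le (h.measurable_norm_jac s k) (h.measurable_norm_jac s l) (by positivity)
        (h.jac_le s k) (h.jac_le s l))
      (eLpNorm_one_mul_le ((h.measurable_norm_netOut s).add_const _) (h.measurable_norm_jac₂ s k l)
        (by positivity) (h.residual_le hy s) (h.jac₂_le s k l hlt))

end HasMomentBounds

end Expectations

section AlmostEverywhere

open Filter

variable {L d dIn dOut n : ℕ} {P : Measure ℝ}

theorem ae_dotProduct_ne_zero [IsProbabilityMeasure P] [NullSingletonClass P] {ι : Type*}
    [Fintype ι] {u : ι → ℝ} (hu : u ≠ 0) : ∀ᵐ w ∂(rowLaw P ι), w ⬝ᵥ u ≠ 0 := by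
  classical
  obtain ⟨j, hj⟩ := Function.ne_iff.mp hu
  have hmeas : MeasurableSet {w : ι → ℝ | w ⬝ᵥ u ≠ 0} :=
    (measurable_dotProduct_const u (measurableSet_singleton 0)).compl
  refine ae_pi_of_forall_ae_update (fun _ => P) hmeas j fun w => ?_
  have hupdate (t : ℝ) : Function.update w j t ⬝ᵥ u = w ⬝ᵥ u + (t - w j) * u j := by
    have hsplit : Function.update w j t = w + Pi.single j (t - w j) := by
      ext i
      rcases eq_or_ne i j with rfl | hi <;> simp [*]
    rw [hsplit, add_dotProduct, single_dotProduct]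
  have hroot : {t | Function.update w j t ⬝ᵥ u = 0}.Subsingleton := fun s hs t ht =>
    sub_left_injective (mul_right_cancel₀ hj (add_left_cancel
      (((hupdate s).symm.trans hs).trans (ht.symm.trans (hupdate t)))))
  simpa [ae_iff] using hroot.measure_zero P

theorem ae_apply_preact_eq_zero_or_preact_ne_zero [IsProbabilityMeasure P] [NullSingletonClass P]
    (act : Activation) (z : Fin d → ℝ) (b : Fin L) (i : Fin d) :
    ∀ᵐ W ∂(initLaw P L d),
      (fun j => act.apply (preact act W z b j)) = 0 ∨ preact act W z (b + 1) i ≠ 0 := by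
  have hpreact (m : ℕ) : Measurable fun W : Weights L d => preact act W z m :=
    measurable_preact act measurable_id measurable_const m
  have hact : Measurable fun W : Weights L d => fun j => act.apply (preact act W z b j) :=
    measurable_pi_lambda _ fun j => act.continuous_apply.measurable.comp (hpreact b).eval
  have hmeas := (hact (measurableSet_singleton 0)).union
    ((hpreact (b + 1)).eval (a := i) (measurableSet_singleton 0)).compl
  refine ae_pi_of_forall_ae_update (fun _ : Fin L => matLaw P (Fin d) (Fin d)) hmeas b fun W => ?_
  have hbelow (w : Fin d → Fin d → ℝ) :
      preact act (Function.update W b w) z b = preact act W z b :=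
    dependsOn_preact act z b fun j hj => Function.update_of_ne (Fin.ne_of_lt hj) _ _
  simp only [preact_succ, layer, b.isLt, dite_true, Function.update_self, hbelow]
  rcases eq_or_ne (fun j => act.apply (preact act W z b j)) 0 with hoff | hon
  · exact ae_of_all _ fun w => Or.inl hoff
  · have hrow := (measurePreserving_eval (fun _ : Fin d => rowLaw P (Fin d)) i)
      |>.quasiMeasurePreserving.ae (ae_dotProduct_ne_zero hon)
    exact hrow.mono fun w hw => Or.inr hw

theorem continuous_preact (act : Activation) (z : Fin d → ℝ) (b : ℕ) :
    Continuous fun W : Weights L d => preact act W z b := by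
  induction b with
  | zero => exact continuous_const
  | succ b ih =>
    have hlayer : Continuous fun W : Weights L d => layer W b :=
      continuous_matrix fun i j => (contDiff_layer_apply b i j).continuous
    have hact := act.continuous_apply
    simp only [preact_succ]
    exact hlayer.matrix_mulVec (by fun_prop)

theorem Activation.eventually_gate_eq (act : Activation) {t : ℝ} (ht : t ≠ 0) :
    ∀ᶠ s in 𝓝 t, act.gate s = act.gate t := by
  cases act with
  | linear => exact Eventually.of_forall fun _ => rfl
  | relu =>
    rcases ht.lt_or_gt with h | h
    · filter_upwards [eventually_lt_nhds h] with s hs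
      simp only [gate, hs.not_gt, h.not_gt]
    · filter_upwards [eventually_gt_nhds h] with s hs
      simp only [gate, hs, h]

theorem relu_apply_preact_eq_zero_of_gates_eq {V W : Weights L d} {z : Fin d → ℝ} {b : ℕ}
    (hgates : gates .relu V z b = gates .relu W z b)
    (hoff : (fun j => Activation.relu.apply (preact .relu W z b j)) = 0) :
    (fun j => Activation.relu.apply (preact .relu V z b j)) = 0 := by
  ext j
  have hgate : Activation.relu.gate (preact .relu W z b j) = 0 :=
    if_neg (max_eq_right_iff.mp (congrFun hoff j)).not_gt
  have hgate' : Activation.relu.gate (preact .relu V z b j) = 0 := (congrFun hgates j).trans hgate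
  rw [← Activation.gate_mul_self, hgate', zero_mul, Pi.zero_apply]

theorem eventually_gates_eq {W : Weights L d} {z : Fin d → ℝ}
    (h : ∀ (b : Fin L) i, (fun j => Activation.relu.apply (preact .relu W z b j)) = 0 ∨
      preact .relu W z (b + 1) i ≠ 0) {b : ℕ} (hb : b ≤ L) :
    ∀ᶠ V in 𝓝 W, gates .relu V z b = gates .relu W z b := by
  induction b with
  | zero => exact Eventually.of_forall fun _ => rfl
  | succ b ih =>
    by_cases hoff : (fun j => Activation.relu.apply (preact .relu W z b j)) = 0
    · filter_upwards [ih (Nat.le_of_succ_le hb)] with V hV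
      have hzero := relu_apply_preact_eq_zero_of_gates_eq hV hoff
      ext i
      simp only [gates, preact_succ, hoff, hzero, Matrix.mulVec_zero]
    · have hunit (i : Fin d) : ∀ᶠ V in 𝓝 W, gates .relu V z (b + 1) i = gates .relu W z (b + 1) i :=
        ((continuous_apply i).comp (continuous_preact .relu z (b + 1))).continuousAt.eventually
          (Activation.relu.eventually_gate_eq ((h ⟨b, hb⟩ i).resolve_left hoff))
      exact (eventually_all.mpr hunit).mono fun V hV => funext hV

theorem ae_eventually_gates_eq [IsProbabilityMeasure P] (act : Activation)
    (hact : act = Activation.linear ∨ ∀ t : ℝ, P {t} = 0) (z : Fin d → ℝ) :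
    ∀ᵐ W ∂(initLaw P L d), ∀ b ≤ L, ∀ᶠ V in 𝓝 W, gates act V z b = gates act W z b := by
  cases act with
  | linear => exact ae_of_all _ fun W b _ => Eventually.of_forall fun V => rfl
  | relu =>
    have : NullSingletonClass P := ⟨hact.resolve_left nofun⟩
    have hae := ae_all_iff.mpr fun b : Fin L => ae_all_iff.mpr fun i =>
      ae_apply_preact_eq_zero_or_preact_ne_zero (P := P) .relu z b i
    filter_upwards [hae] with W hW b hb using eventually_gates_eq hW hb

theorem chain_congr_gates {D D' : ℕ → Fin d → ℝ} (V : Weights L d) {a b : ℕ}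
    (h : ∀ m ≤ b, D m = D' m) : chain D V a b = chain D' V a b := by
  induction b with
  | zero => simp only [chain, h 0 le_rfl]
  | succ b ih => simp only [chain, h (b + 1) le_rfl, ih fun m hm => h m (Nat.le_succ_of_le hm)]

theorem loss_eventuallyEq_gatedLoss (act : Activation) (A : Matrix (Fin d) (Fin dIn) ℝ)
    (B : Matrix (Fin dOut) (Fin d) ℝ) (x : Fin n → Fin dIn → ℝ) (y : Fin n → Fin dOut → ℝ)
    {W : Weights L d}
    (h : ∀ s, ∀ b ≤ L, ∀ᶠ V in 𝓝 W, gates act V (A *ᵥ x s) b = gates act W (A *ᵥ x s) b) :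
    loss act A B x y =ᶠ[𝓝 W] gatedLoss act A B x y W := by
  have hall : ∀ᶠ V in 𝓝 W, ∀ s, ∀ b ∈ Set.Iic L,
      gates act V (A *ᵥ x s) b = gates act W (A *ᵥ x s) b :=
    eventually_all.mpr fun s => (eventually_all_finite (Set.finite_Iic L)).mpr (h s)
  filter_upwards [hall] with V hV
  rw [← gatedLoss_self, gatedLoss_eq_chainLoss, gatedLoss_eq_chainLoss]
  simp only [chainLoss, netOut, chain_congr_gates V (hV _)]

theorem gradBlock_congr {f g : Weights L d → ℝ} {W : Weights L d} (h : f =ᶠ[𝓝 W] g) (k : Fin L) :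
    gradBlock f W k = gradBlock g W k := by
  simp only [gradBlock, h.fderiv_eq]

theorem hessBlock_congr {f g : Weights L d → ℝ} {W : Weights L d} (h : f =ᶠ[𝓝 W] g)
    (k l : Fin L) : hessBlock f W k l = hessBlock g W k l := by
  have hfderiv (v : Weights L d) : (fun V => fderiv ℝ f V v) =ᶠ[𝓝 W] fun V => fderiv ℝ g V v :=
    h.fderiv.mono fun V hV => DFunLike.congr_fun hV v
  simp only [hessBlock, (hfderiv _).fderiv_eq]

theorem ae_loss_eventuallyEq_gatedLoss [IsProbabilityMeasure P] (act : Activation)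
    (hact : act = Activation.linear ∨ ∀ t : ℝ, P {t} = 0) (A : Matrix (Fin d) (Fin dIn) ℝ)
    (B : Matrix (Fin dOut) (Fin d) ℝ) (x : Fin n → Fin dIn → ℝ) (y : Fin n → Fin dOut → ℝ) :
    ∀ᵐ W ∂(initLaw P L d), loss act A B x y =ᶠ[𝓝 W] gatedLoss act A B x y W := by
  have hgates := ae_all_iff.mpr fun s => ae_eventually_gates_eq (L := L) act hact (A *ᵥ x s)
  filter_upwards [hgates] with W hW using loss_eventuallyEq_gatedLoss act A B x y hW

end AlmostEverywhere

section Scaling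

/-- The factor in front of the powers of `lam` in all bounds on expectations, for a network whose
output and derivatives have moment bounds with the factor `c` and whose targets have norm at most
`R`. -/
noncomputable def momentConst (c R : ℝ) : ℝ := 4 * (c ^ 2 + c * R)

theorem le_momentConst_mul {c R e u b : ℝ} (hc : 0 ≤ c) (hR : 0 ≤ R)
    (he : e ≤ (c ^ 2 + c * R) * u) (hu : u ≤ 4 * b) : e ≤ momentConst c R * b :=
  calc e ≤ (c ^ 2 + c * R) * (4 * b) := he.trans (by gcongr)
    _ = momentConst c R * b := by unfold momentConst; ring

theorem rpow_mul_rpow_of_add_eq {t a b c : ℝ} (ht : 0 ≤ t) (ha : 0 ≤ a) (hb : 0 ≤ b)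
    (h : a + b = c) : t ^ a * t ^ b = t ^ c := by
  rw [← Real.rpow_add_of_nonneg ht ha hb, h]

theorem rpow_half_sq {t a : ℝ} {m : ℕ} (ht : 0 ≤ t) (h : a = m) : (t ^ (a / 2)) ^ 2 = t ^ m := by
  rw [← Real.rpow_mul_natCast ht, h, Nat.cast_ofNat, div_mul_cancel₀ _ two_ne_zero,
    Real.rpow_natCast]

theorem sqrt_div_mul_rpow_half {t : ℝ} (ht : 0 < t) (δ r : ℝ) :
    √(δ / t) * t ^ (r / 2) = √δ * t ^ ((r - 1) / 2) := by
  rw [Real.sqrt_div' δ ht.le, sub_div, Real.rpow_sub ht, ← Real.sqrt_eq_rpow]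
  ring

variable (act : Activation) (d : ℕ) (σ : ℝ)

theorem widthFactor_nonneg : 0 ≤ act.widthFactor d := by
  cases act
  exacts [zero_le_one, d.cast_nonneg]

theorem widthFactor_mul_lam_rpow_le {s : ℝ} (hs : 0 < s) :
    act.widthFactor d * lam act d σ ^ s ≤ √(d * act.widthFactor d) * lam act d σ ^ s := by
  rcases d.eq_zero_or_pos with rfl | hd
  · simp [lam, Real.zero_rpow hs.ne']
  have hd1 : (1 : ℝ) ≤ d := Nat.one_le_cast.mpr hd
  refine mul_le_mul_of_nonneg_right (Real.le_sqrt_of_sq_le ?_)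
    (Real.rpow_nonneg (lam_nonneg act d σ) s)
  cases act
  · simpa [Activation.widthFactor] using hd1
  · exact (sq (d : ℝ)).le

theorem lam_rpow_le_sqrt_mul {s : ℝ} (hs : 0 < s) :
    lam act d σ ^ s ≤ √d * lam act d σ ^ s := by
  rcases d.eq_zero_or_pos with rfl | hd
  · simp [lam, Real.zero_rpow hs.ne']
  exact le_mul_of_one_le_left (Real.rpow_nonneg (lam_nonneg act d σ) s)
    (Real.one_le_sqrt.mpr (Nat.one_le_cast.mpr hd))

theorem width_mul_sq_le_two_mul_lam : d * σ ^ 2 ≤ 2 * lam act d σ := by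
  have : (0 : ℝ) ≤ d * σ ^ 2 := by positivity
  cases act <;> simp only [lam, Activation.p] <;> linarith

theorem sqrt_inv_natCast_le_one : √((d : ℝ)⁻¹) ≤ 1 :=
  Real.sqrt_le_one.mpr (Nat.cast_inv_le_one d)

theorem sqrt_inv_natCast_mul_sqrt_le_one : √((d : ℝ)⁻¹) * √d ≤ 1 := by
  rw [Real.sqrt_inv]
  exact inv_mul_le_one

end Scaling

section FixedInputOutput

variable {n dIn dOut d L : ℕ} {act : Activation} {P : Measure ℝ} {σ R : ℝ}
  {A : Matrix (Fin d) (Fin dIn) ℝ} {B : Matrix (Fin dOut) (Fin d) ℝ}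
  {z : Fin d → ℝ} {x : Fin n → Fin dIn → ℝ} {y : Fin n → Fin dOut → ℝ}

theorem eLpNorm_netOut_initLaw_le (hP : act.IsAdmissibleLaw P σ) (hB : frobNorm B ≤ R)
    (hz : euclNorm z ≤ R) :
    eLpNorm (fun W : Weights L d => euclNorm (netOut B (gates act W z) z W)) 2 (initLaw P L d) ≤
      ENNReal.ofReal (R ^ 2 * lam act d σ ^ ((L : ℝ) / 2)) := by
  have ht := lam_nonneg act d σ
  have hB0 := frobNorm_nonneg B
  have hz0 := euclNorm_nonneg z
  refine eLpNorm_two_le_of_lintegral_sq_le (by positivity)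
    ((lintegral_netOut_sq_le hP B z).trans (ENNReal.ofReal_le_ofReal ?_))
  calc frobNorm B ^ 2 * lam act d σ ^ L * euclNorm z ^ 2
      ≤ R ^ 2 * lam act d σ ^ L * R ^ 2 := by gcongr
    _ = _ := by rw [mul_pow, rpow_half_sq ht rfl]; ring

theorem eLpNorm_jac_initLaw_le (hP : act.IsAdmissibleLaw P σ) (hB : frobNorm B ≤ R)
    (hz : euclNorm z ≤ R) (k : Fin L) :
    eLpNorm (fun W : Weights L d => frobNorm (jac B (gates act W z) z W k)) 2 (initLaw P L d) ≤
      ENNReal.ofReal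
        (R ^ 2 * (√(act.widthFactor d) * lam act d σ ^ (((L : ℝ) - 1) / 2))) := by
  have ht := lam_nonneg act d σ
  have hδ := widthFactor_nonneg act d
  have hB0 := frobNorm_nonneg B
  have hz0 := euclNorm_nonneg z
  have hL : (L : ℝ) - 1 = (L - 1 : ℕ) := (Nat.cast_pred k.pos).symm
  refine eLpNorm_two_le_of_lintegral_sq_le (by positivity)
    ((lintegral_jac_sq_le hP z k (by positivity) fun a ha => condExpLE_mul_chain hP B z ha).trans
      (ENNReal.ofReal_le_ofReal ?_))
  calc act.widthFactor d * frobNorm B ^ 2 * lam act d σ ^ (L - 1) * euclNorm z ^ 2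
      ≤ act.widthFactor d * R ^ 2 * lam act d σ ^ (L - 1) * R ^ 2 := by gcongr
    _ = _ := by rw [mul_pow, mul_pow, rpow_half_sq ht hL, Real.sq_sqrt hδ]; ring

theorem eLpNorm_jac₂_initLaw_le (hP : act.IsAdmissibleLaw P σ) (hB : frobNorm B ≤ R)
    (hz : euclNorm z ≤ R) {k l : Fin L} (hkl : k < l) :
    eLpNorm (fun W : Weights L d => frobNorm (jac₂ B (gates act W z) z W k l)) 2
        (initLaw P L d) ≤
      ENNReal.ofReal
        (R ^ 2 * (√(d * act.widthFactor d) * lam act d σ ^ (((L : ℝ) - 2) / 2))) := by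
  have ht := lam_nonneg act d σ
  have hδ := widthFactor_nonneg act d
  have hB0 := frobNorm_nonneg B
  have hz0 := euclNorm_nonneg z
  have hL : (L : ℝ) - 2 = (L - 2 : ℕ) := (Nat.cast_sub (by lia)).symm
  refine eLpNorm_two_le_of_lintegral_sq_le (by positivity)
    ((lintegral_jac₂_sq_le hP z hkl (by positivity) fun a ha =>
      condExpLE_mul_chain hP B z ha).trans (ENNReal.ofReal_le_ofReal ?_))
  calc act.widthFactor d * frobNorm B ^ 2 * d * lam act d σ ^ (L - 2) * euclNorm z ^ 2
      ≤ act.widthFactor d * R ^ 2 * d * lam act d σ ^ (L - 2) * R ^ 2 := by gcongr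
    _ = _ := by rw [mul_pow, mul_pow, rpow_half_sq ht hL, Real.sq_sqrt (by positivity)]; ring

theorem hasMomentBounds_initLaw (hP : act.IsAdmissibleLaw P σ) (hB : frobNorm B ≤ R)
    (hx : ∀ s, euclNorm (A *ᵥ x s) ≤ R) :
    HasMomentBounds act (initLaw P L d) (fun _ => A) (fun _ => B) (fun W => W) x (R ^ 2)
      (lam act d σ ^ ((L : ℝ) / 2))
      (√(act.widthFactor d) * lam act d σ ^ (((L : ℝ) - 1) / 2))
      (√(d * act.widthFactor d) * lam act d σ ^ (((L : ℝ) - 2) / 2)) where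
  measurable_input _ _ := measurable_const
  measurable_output _ _ := measurable_const
  measurable_weights := measurable_id
  nonneg := sq_nonneg R
  nonneg₀ := Real.rpow_nonneg (lam_nonneg act d σ) _
  nonneg₁ := mul_nonneg (Real.sqrt_nonneg _) (Real.rpow_nonneg (lam_nonneg act d σ) _)
  nonneg₂ := mul_nonneg (Real.sqrt_nonneg _) (Real.rpow_nonneg (lam_nonneg act d σ) _)
  netOut_le s := eLpNorm_netOut_initLaw_le hP hB (hx s)
  jac_le s k := eLpNorm_jac_initLaw_le hP hB (hx s) k
  jac₂_le s _ _ hkl := eLpNorm_jac₂_initLaw_le hP hB (hx s) hkl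

theorem integral_gradNorm_initLaw_le (hP : act.IsAdmissibleLaw P σ) (hB : frobNorm B ≤ R)
    (hx : ∀ s, euclNorm (A *ᵥ x s) ≤ R) (hy : ∀ s, euclNorm (y s) ≤ R) (k : Fin L) :
    Integrable (fun W => gradNorm act A B x y W k) (initLaw P L d) ∧
      ∫ W, gradNorm act A B x y W k ∂(initLaw P L d) ≤
        momentConst (R ^ 2) R * √(act.widthFactor d) *
          (lam act d σ ^ (((L : ℝ) - 1) / 2) + lam act d σ ^ ((2 * (L : ℝ) - 1) / 2)) ∧
      (0 < lam act d σ → lam act d σ ≤ 1 →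
        ∫ W, gradNorm act A B x y W k ∂(initLaw P L d) ≤
          momentConst (R ^ 2) R * √(act.widthFactor d / lam act d σ) *
            lam act d σ ^ ((L : ℝ) / 2)) := by
  have := hP.isProbabilityMeasure
  have hR : 0 ≤ R := (frobNorm_nonneg B).trans hB
  have hc : 0 ≤ R ^ 2 := sq_nonneg R
  have hL : (1 : ℝ) ≤ L := Nat.one_le_cast.mpr k.pos
  obtain ⟨hint, hle⟩ := (hasMomentBounds_initLaw hP hB hx).integral_gradNorm_le hR hy k
  have ht := lam_nonneg act d σ
  generalize lam act d σ = t at ht hle ⊢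
  have hprod : t ^ ((L : ℝ) / 2) * t ^ (((L : ℝ) - 1) / 2) = t ^ ((2 * (L : ℝ) - 1) / 2) :=
    rpow_mul_rpow_of_add_eq ht (by positivity) (by linarith) (by ring)
  rw [mul_left_comm (t ^ _), hprod, ← mul_add] at hle
  refine ⟨hint, ?_, fun ht0 ht1 => ?_⟩
  · refine (le_momentConst_mul hc hR hle (le_mul_of_one_le_left ?_ ?_)).trans_eq (by ring)
    exacts [by positivity, by norm_num]
  · refine (le_momentConst_mul hc hR hle ?_).trans_eq (mul_assoc _ _ _).symm
    rw [sqrt_div_mul_rpow_half ht0, mul_left_comm]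
    gcongr
    have := Real.rpow_nonneg ht (((L : ℝ) - 1) / 2)
    have hdecay : t ^ ((2 * (L : ℝ) - 1) / 2) ≤ t ^ (((L : ℝ) - 1) / 2) :=
      Real.rpow_le_rpow_of_exponent_ge' ht ht1 (by linarith) (by linarith)
    linarith

theorem integral_hessNorm_self_initLaw_le (hP : act.IsAdmissibleLaw P σ) (hB : frobNorm B ≤ R)
    (hx : ∀ s, euclNorm (A *ᵥ x s) ≤ R) (k : Fin L) :
    Integrable (fun W => hessNorm act A B x y W k k) (initLaw P L d) ∧
      ∫ W, hessNorm act A B x y W k k ∂(initLaw P L d) ≤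
        momentConst (R ^ 2) R * act.widthFactor d * lam act d σ ^ ((L : ℝ) - 1) ∧
      (0 < lam act d σ →
        ∫ W, hessNorm act A B x y W k k ∂(initLaw P L d) ≤
          momentConst (R ^ 2) R * (act.widthFactor d / lam act d σ) *
            lam act d σ ^ (L : ℝ)) := by
  have hR : 0 ≤ R := (frobNorm_nonneg B).trans hB
  have hδ := widthFactor_nonneg act d
  have hL : (1 : ℝ) ≤ L := Nat.one_le_cast.mpr k.pos
  obtain ⟨hint, hle⟩ := (hasMomentBounds_initLaw hP hB hx).integral_hessNorm_self_le (y := y) hR k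
  have ht := lam_nonneg act d σ
  generalize lam act d σ = t at ht hle ⊢
  have hprod : t ^ (((L : ℝ) - 1) / 2) * t ^ (((L : ℝ) - 1) / 2) = t ^ ((L : ℝ) - 1) :=
    rpow_mul_rpow_of_add_eq ht (by linarith) (by linarith) (by ring)
  rw [mul_mul_mul_comm √_, hprod, Real.mul_self_sqrt hδ] at hle
  have hmain := le_momentConst_mul (sq_nonneg R) hR hle
    (le_mul_of_one_le_left (by positivity) (by norm_num))
  refine ⟨hint, hmain.trans_eq (mul_assoc _ _ _).symm, fun ht0 => hmain.trans_eq ?_⟩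
  rw [Real.rpow_sub_one ht0.ne']
  ring

theorem integral_hessNorm_initLaw_le (hP : act.IsAdmissibleLaw P σ) (hB : frobNorm B ≤ R)
    (hx : ∀ s, euclNorm (A *ᵥ x s) ≤ R) (hy : ∀ s, euclNorm (y s) ≤ R) {k l : Fin L} (hkl : k ≠ l) :
    Integrable (fun W => hessNorm act A B x y W k l) (initLaw P L d) ∧
      ∫ W, hessNorm act A B x y W k l ∂(initLaw P L d) ≤
        momentConst (R ^ 2) R * √(d * act.widthFactor d) *
          (lam act d σ ^ (((L : ℝ) - 2) / 2) + lam act d σ ^ ((L : ℝ) - 1)) ∧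
      (0 < lam act d σ → lam act d σ ≤ 1 →
        ∫ W, hessNorm act A B x y W k l ∂(initLaw P L d) ≤
          momentConst (R ^ 2) R * (√(d * act.widthFactor d) / lam act d σ) *
            lam act d σ ^ ((L : ℝ) / 2)) := by
  have := hP.isProbabilityMeasure
  have hR : 0 ≤ R := (frobNorm_nonneg B).trans hB
  have hc : 0 ≤ R ^ 2 := sq_nonneg R
  have hδ := widthFactor_nonneg act d
  have hL : (2 : ℝ) ≤ L := Nat.ofNat_le_cast.mpr (by have := Fin.val_ne_of_ne hkl; lia)
  have hwidth := widthFactor_mul_lam_rpow_le act d σ (s := (L : ℝ) - 1) (by linarith)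
  obtain ⟨hint, hle⟩ := (hasMomentBounds_initLaw hP hB hx).integral_hessNorm_le hR hy hkl
  have ht := lam_nonneg act d σ
  generalize lam act d σ = t at ht hle hwidth ⊢
  have hfirst : t ^ (((L : ℝ) - 1) / 2) * t ^ (((L : ℝ) - 1) / 2) = t ^ ((L : ℝ) - 1) :=
    rpow_mul_rpow_of_add_eq ht (by linarith) (by linarith) (by ring)
  have hsecond : t ^ ((L : ℝ) / 2) * t ^ (((L : ℝ) - 2) / 2) = t ^ ((L : ℝ) - 1) :=
    rpow_mul_rpow_of_add_eq ht (by linarith) (by linarith) (by ring)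
  rw [mul_mul_mul_comm √(act.widthFactor d), hfirst, Real.mul_self_sqrt hδ,
    mul_left_comm (t ^ ((L : ℝ) / 2)), hsecond] at hle
  have hp : 0 ≤ √(d * act.widthFactor d) * t ^ (((L : ℝ) - 2) / 2) := by positivity
  refine ⟨hint, ?_, fun ht0 ht1 => ?_⟩
  · refine (le_momentConst_mul hc hR hle ?_).trans_eq (mul_assoc _ _ _).symm
    have : 0 ≤ √(d * act.widthFactor d) * t ^ ((L : ℝ) - 1) := by positivity
    linarith
  · refine (le_momentConst_mul hc hR hle ?_).trans_eq (mul_assoc _ _ _).symm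
    have hdecay : √(d * act.widthFactor d) * t ^ ((L : ℝ) - 1) ≤
        √(d * act.widthFactor d) * t ^ (((L : ℝ) - 2) / 2) :=
      mul_le_mul_of_nonneg_left
        (Real.rpow_le_rpow_of_exponent_ge' ht ht1 (by linarith) (by linarith)) (Real.sqrt_nonneg _)
    rw [div_mul_eq_mul_div, mul_div_assoc, ← Real.rpow_sub_one ht0.ne',
      show (L : ℝ) / 2 - 1 = ((L : ℝ) - 2) / 2 by ring]
    linarith

end FixedInputOutput

section RandomInputOutput

variable {n dIn dOut d L : ℕ} {act : Activation} {P : Measure ℝ} {σ R : ℝ}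
  {v : Fin dIn → ℝ} {x : Fin n → Fin dIn → ℝ} {y : Fin n → Fin dOut → ℝ}

theorem width_mul_sq_mul_sq_le (act : Activation) (d : ℕ) (σ : ℝ) (hv : euclNorm v ≤ R) :
    d * σ ^ 2 * euclNorm v ^ 2 ≤ 2 * lam act d σ * R ^ 2 := by
  have ht := lam_nonneg act d σ
  exact mul_le_mul (width_mul_sq_le_two_mul_lam act d σ)
    (pow_le_pow_left₀ (euclNorm_nonneg v) hv 2) (sq_nonneg _) (by positivity)

theorem eLpNorm_netOut_jointLaw_le (hP : act.IsAdmissibleLaw P σ) (hR : 0 ≤ R)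
    (hv : euclNorm v ≤ R) :
    eLpNorm (fun θ => euclNorm (netOut (Matrix.of θ.2.1)
        (gates act θ.2.2 (Matrix.of θ.1 *ᵥ v)) (Matrix.of θ.1 *ᵥ v) θ.2.2)) 2
        (jointLaw P dIn dOut d L) ≤
      ENNReal.ofReal (2 * √dOut * R * (√(d : ℝ)⁻¹ * lam act d σ ^ (((L : ℝ) + 2) / 2))) := by
  have ht := lam_nonneg act d σ
  have hdσ := width_mul_sq_le_two_mul_lam act d σ
  have hinput := width_mul_sq_mul_sq_le act d σ hv
  have hL : (L : ℝ) + 2 = (L + 2 : ℕ) := by push_cast; rfl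
  refine eLpNorm_two_le_of_lintegral_sq_le (by positivity)
    ((lintegral_jointLaw_netOut_sq_le hP v).trans (ENNReal.ofReal_le_ofReal ?_))
  calc dOut * σ ^ 2 * lam act d σ ^ L * (d * σ ^ 2 * euclNorm v ^ 2)
      = dOut * (d : ℝ)⁻¹ * lam act d σ ^ L * (d * σ ^ 2) * (d * σ ^ 2 * euclNorm v ^ 2) := by
        linear_combination (-(dOut * lam act d σ ^ L * σ ^ 4 * euclNorm v ^ 2)) *
          mul_self_mul_inv (d : ℝ)
    _ ≤ dOut * (d : ℝ)⁻¹ * lam act d σ ^ L * (2 * lam act d σ) * (2 * lam act d σ * R ^ 2) := by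
        gcongr dOut * (d : ℝ)⁻¹ * lam act d σ ^ L * ?_ * ?_
    _ = _ := by
        simp only [mul_pow, rpow_half_sq ht hL, Real.sq_sqrt (Nat.cast_nonneg dOut),
          Real.sq_sqrt (inv_nonneg.mpr (Nat.cast_nonneg d))]
        ring

theorem eLpNorm_jac_jointLaw_le (hP : act.IsAdmissibleLaw P σ) (hR : 0 ≤ R)
    (hv : euclNorm v ≤ R) (k : Fin L) :
    eLpNorm (fun θ => frobNorm (jac (Matrix.of θ.2.1)
        (gates act θ.2.2 (Matrix.of θ.1 *ᵥ v)) (Matrix.of θ.1 *ᵥ v) θ.2.2 k)) 2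
        (jointLaw P dIn dOut d L) ≤
      ENNReal.ofReal (2 * √dOut * R * lam act d σ ^ (((L : ℝ) + 1) / 2)) := by
  have ht := lam_nonneg act d σ
  have hdσ := width_mul_sq_le_two_mul_lam act d σ
  have hinput := width_mul_sq_mul_sq_le act d σ hv
  have hL : (L : ℝ) + 1 = (L - 1 + 2 : ℕ) := by
    have := k.pos
    norm_cast
    lia
  refine eLpNorm_two_le_of_lintegral_sq_le (by positivity)
    ((lintegral_jointLaw_jac_sq_le hP v k).trans (ENNReal.ofReal_le_ofReal ?_))
  calc dOut * σ ^ 2 * (d * lam act d σ ^ (L - 1)) * (d * σ ^ 2 * euclNorm v ^ 2)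
      = dOut * lam act d σ ^ (L - 1) * (d * σ ^ 2) * (d * σ ^ 2 * euclNorm v ^ 2) := by ring
    _ ≤ dOut * lam act d σ ^ (L - 1) * (2 * lam act d σ) * (2 * lam act d σ * R ^ 2) := by
        gcongr dOut * lam act d σ ^ (L - 1) * ?_ * ?_
    _ = _ := by
        simp only [mul_pow, rpow_half_sq ht hL, Real.sq_sqrt (Nat.cast_nonneg dOut)]
        ring

theorem eLpNorm_jac₂_jointLaw_le (hP : act.IsAdmissibleLaw P σ) (hR : 0 ≤ R)
    (hv : euclNorm v ≤ R) {k l : Fin L} (hkl : k < l) :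
    eLpNorm (fun θ => frobNorm (jac₂ (Matrix.of θ.2.1)
        (gates act θ.2.2 (Matrix.of θ.1 *ᵥ v)) (Matrix.of θ.1 *ᵥ v) θ.2.2 k l)) 2
        (jointLaw P dIn dOut d L) ≤
      ENNReal.ofReal (2 * √dOut * R * (√d * lam act d σ ^ ((L : ℝ) / 2))) := by
  have ht := lam_nonneg act d σ
  have hdσ := width_mul_sq_le_two_mul_lam act d σ
  have hinput := width_mul_sq_mul_sq_le act d σ hv
  have hL : (L : ℝ) = (L - 2 + 2 : ℕ) := by
    congr 1
    lia
  refine eLpNorm_two_le_of_lintegral_sq_le (by positivity)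
    ((lintegral_jointLaw_jac₂_sq_le hP v hkl).trans (ENNReal.ofReal_le_ofReal ?_))
  calc dOut * σ ^ 2 * (d * d * lam act d σ ^ (L - 2)) * (d * σ ^ 2 * euclNorm v ^ 2)
      = dOut * d * lam act d σ ^ (L - 2) * (d * σ ^ 2) * (d * σ ^ 2 * euclNorm v ^ 2) := by ring
    _ ≤ dOut * d * lam act d σ ^ (L - 2) * (2 * lam act d σ) * (2 * lam act d σ * R ^ 2) := by
        gcongr dOut * d * lam act d σ ^ (L - 2) * ?_ * ?_
    _ = _ := by
        simp only [mul_pow, rpow_half_sq ht hL, Real.sq_sqrt (Nat.cast_nonneg dOut),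
          Real.sq_sqrt (Nat.cast_nonneg d)]
        ring

theorem hasMomentBounds_jointLaw (hP : act.IsAdmissibleLaw P σ) (hR : 0 ≤ R)
    (hx : ∀ s, euclNorm (x s) ≤ R) :
    HasMomentBounds act (jointLaw P dIn dOut d L) (fun θ => Matrix.of θ.1)
      (fun θ => Matrix.of θ.2.1) (fun θ => θ.2.2) x (2 * √dOut * R)
      (√(d : ℝ)⁻¹ * lam act d σ ^ (((L : ℝ) + 2) / 2)) (lam act d σ ^ (((L : ℝ) + 1) / 2))
      (√d * lam act d σ ^ ((L : ℝ) / 2)) where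
  measurable_input := measurable_of_apply measurable_fst
  measurable_output := measurable_of_apply (measurable_fst.comp measurable_snd)
  measurable_weights := measurable_snd.comp measurable_snd
  nonneg := mul_nonneg (by positivity) hR
  nonneg₀ := mul_nonneg (Real.sqrt_nonneg _) (Real.rpow_nonneg (lam_nonneg act d σ) _)
  nonneg₁ := Real.rpow_nonneg (lam_nonneg act d σ) _
  nonneg₂ := mul_nonneg (Real.sqrt_nonneg _) (Real.rpow_nonneg (lam_nonneg act d σ) _)
  netOut_le s := eLpNorm_netOut_jointLaw_le hP hR (hx s)
  jac_le s k := eLpNorm_jac_jointLaw_le hP hR (hx s) k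
  jac₂_le s _ _ hkl := eLpNorm_jac₂_jointLaw_le hP hR (hx s) hkl

theorem integral_gradNorm_jointLaw_le (hP : act.IsAdmissibleLaw P σ) (hR : 0 ≤ R)
    (hx : ∀ s, euclNorm (x s) ≤ R) (hy : ∀ s, euclNorm (y s) ≤ R) (k : Fin L) :
    Integrable (fun θ => gradNorm act (Matrix.of θ.1) (Matrix.of θ.2.1) x y θ.2.2 k)
        (jointLaw P dIn dOut d L) ∧
      ∫ θ, gradNorm act (Matrix.of θ.1) (Matrix.of θ.2.1) x y θ.2.2 k
          ∂(jointLaw P dIn dOut d L) ≤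
        momentConst (2 * √dOut * R) R *
          (lam act d σ ^ (((L : ℝ) + 1) / 2) + lam act d σ ^ ((2 * (L : ℝ) + 3) / 2)) ∧
      (lam act d σ ≤ 1 →
        ∫ θ, gradNorm act (Matrix.of θ.1) (Matrix.of θ.2.1) x y θ.2.2 k
            ∂(jointLaw P dIn dOut d L) ≤
          momentConst (2 * √dOut * R) R * lam act d σ ^ ((L : ℝ) / 2)) := by
  have := hP.isProbabilityMeasure
  have hc : 0 ≤ 2 * √dOut * R := by positivity
  obtain ⟨hint, hle⟩ := (hasMomentBounds_jointLaw (L := L) hP hR hx).integral_gradNorm_le hR hy k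
  have ht := lam_nonneg act d σ
  generalize lam act d σ = t at ht hle ⊢
  have hprod : t ^ (((L : ℝ) + 2) / 2) * t ^ (((L : ℝ) + 1) / 2) = t ^ ((2 * (L : ℝ) + 3) / 2) :=
    rpow_mul_rpow_of_add_eq ht (by positivity) (by positivity) (by ring)
  have hwidth : √(d : ℝ)⁻¹ * t ^ ((2 * (L : ℝ) + 3) / 2) ≤ t ^ ((2 * (L : ℝ) + 3) / 2) :=
    mul_le_of_le_one_left (by positivity) (sqrt_inv_natCast_le_one d)
  rw [mul_assoc √_, hprod] at hle
  refine ⟨hint, le_momentConst_mul hc hR hle ?_, fun ht1 => le_momentConst_mul hc hR hle ?_⟩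
  · have : 0 ≤ t ^ (((L : ℝ) + 1) / 2) + t ^ ((2 * (L : ℝ) + 3) / 2) := by positivity
    linarith
  · have : 0 ≤ t ^ ((L : ℝ) / 2) := by positivity
    have hfirst : t ^ (((L : ℝ) + 1) / 2) ≤ t ^ ((L : ℝ) / 2) :=
      Real.rpow_le_rpow_of_exponent_ge' ht ht1 (by positivity) (by linarith)
    have hsecond : t ^ ((2 * (L : ℝ) + 3) / 2) ≤ t ^ ((L : ℝ) / 2) :=
      Real.rpow_le_rpow_of_exponent_ge' ht ht1 (by positivity)
        (by linarith [L.cast_nonneg (α := ℝ)])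
    linarith

theorem integral_hessNorm_self_jointLaw_le (hP : act.IsAdmissibleLaw P σ) (hR : 0 ≤ R)
    (hx : ∀ s, euclNorm (x s) ≤ R) (k : Fin L) :
    Integrable (fun θ => hessNorm act (Matrix.of θ.1) (Matrix.of θ.2.1) x y θ.2.2 k k)
        (jointLaw P dIn dOut d L) ∧
      ∫ θ, hessNorm act (Matrix.of θ.1) (Matrix.of θ.2.1) x y θ.2.2 k k
          ∂(jointLaw P dIn dOut d L) ≤
        momentConst (2 * √dOut * R) R * lam act d σ ^ ((L : ℝ) + 1) ∧
      (lam act d σ ≤ 1 →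
        ∫ θ, hessNorm act (Matrix.of θ.1) (Matrix.of θ.2.1) x y θ.2.2 k k
            ∂(jointLaw P dIn dOut d L) ≤
          momentConst (2 * √dOut * R) R * lam act d σ ^ (L : ℝ)) := by
  have hc : 0 ≤ 2 * √dOut * R := by positivity
  obtain ⟨hint, hle⟩ :=
    (hasMomentBounds_jointLaw (L := L) hP hR hx).integral_hessNorm_self_le (y := y) hR k
  have ht := lam_nonneg act d σ
  generalize lam act d σ = t at ht hle ⊢
  have hprod : t ^ (((L : ℝ) + 1) / 2) * t ^ (((L : ℝ) + 1) / 2) = t ^ ((L : ℝ) + 1) :=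
    rpow_mul_rpow_of_add_eq ht (by positivity) (by positivity) (by ring)
  rw [hprod] at hle
  have hpos : 0 ≤ t ^ ((L : ℝ) + 1) := by positivity
  refine ⟨hint, le_momentConst_mul hc hR hle (by linarith),
    fun ht1 => le_momentConst_mul hc hR hle ?_⟩
  have : t ^ ((L : ℝ) + 1) ≤ t ^ (L : ℝ) :=
    Real.rpow_le_rpow_of_exponent_ge' ht ht1 (by positivity) (by linarith)
  linarith

theorem integral_hessNorm_jointLaw_le (hP : act.IsAdmissibleLaw P σ) (hR : 0 ≤ R)
    (hx : ∀ s, euclNorm (x s) ≤ R) (hy : ∀ s, euclNorm (y s) ≤ R) {k l : Fin L} (hkl : k ≠ l) :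
    Integrable (fun θ => hessNorm act (Matrix.of θ.1) (Matrix.of θ.2.1) x y θ.2.2 k l)
        (jointLaw P dIn dOut d L) ∧
      ∫ θ, hessNorm act (Matrix.of θ.1) (Matrix.of θ.2.1) x y θ.2.2 k l
          ∂(jointLaw P dIn dOut d L) ≤
        momentConst (2 * √dOut * R) R *
          (√d * lam act d σ ^ ((L : ℝ) / 2) + lam act d σ ^ ((L : ℝ) + 1)) ∧
      (lam act d σ ≤ 1 →
        ∫ θ, hessNorm act (Matrix.of θ.1) (Matrix.of θ.2.1) x y θ.2.2 k l
            ∂(jointLaw P dIn dOut d L) ≤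
          momentConst (2 * √dOut * R) R * √d * lam act d σ ^ ((L : ℝ) / 2)) := by
  have := hP.isProbabilityMeasure
  have hc : 0 ≤ 2 * √dOut * R := by positivity
  have hwidth := lam_rpow_le_sqrt_mul act d σ (s := (L : ℝ) + 1) (by positivity)
  obtain ⟨hint, hle⟩ := (hasMomentBounds_jointLaw (L := L) hP hR hx).integral_hessNorm_le hR hy hkl
  have ht := lam_nonneg act d σ
  generalize lam act d σ = t at ht hle hwidth ⊢
  have hfirst : t ^ (((L : ℝ) + 1) / 2) * t ^ (((L : ℝ) + 1) / 2) = t ^ ((L : ℝ) + 1) :=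
    rpow_mul_rpow_of_add_eq ht (by positivity) (by positivity) (by ring)
  have hsecond : t ^ (((L : ℝ) + 2) / 2) * t ^ ((L : ℝ) / 2) = t ^ ((L : ℝ) + 1) :=
    rpow_mul_rpow_of_add_eq ht (by positivity) (by positivity) (by ring)
  have hcancel : √(d : ℝ)⁻¹ * √d * t ^ ((L : ℝ) + 1) ≤ t ^ ((L : ℝ) + 1) :=
    mul_le_of_le_one_left (by positivity) (sqrt_inv_natCast_mul_sqrt_le_one d)
  rw [hfirst, mul_mul_mul_comm √(d : ℝ)⁻¹, hsecond] at hle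
  have hp : 0 ≤ √d * t ^ ((L : ℝ) / 2) := by positivity
  have hq : 0 ≤ t ^ ((L : ℝ) + 1) := by positivity
  refine ⟨hint, le_momentConst_mul hc hR hle (by linarith), fun ht1 => ?_⟩
  refine (le_momentConst_mul hc hR hle ?_).trans_eq (mul_assoc _ _ _).symm
  have hdecay : √d * t ^ ((L : ℝ) + 1) ≤ √d * t ^ ((L : ℝ) / 2) :=
    mul_le_mul_of_nonneg_left
      (Real.rpow_le_rpow_of_exponent_ge' ht ht1 (by positivity) (by linarith)) (Real.sqrt_nonneg _)
  linarith

end RandomInputOutput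

theorem theorem3_general (act : Activation) (R : ℝ) :
    (∃ C : ℝ, ∀ (n dIn dOut d L : ℕ) (P : Measure ℝ) (σ : ℝ)
        (A : Matrix (Fin d) (Fin dIn) ℝ) (B : Matrix (Fin dOut) (Fin d) ℝ)
        (x : Fin n → Fin dIn → ℝ) (y : Fin n → Fin dOut → ℝ),
      act.IsAdmissibleLaw P σ → frobNorm B ≤ R →
      (∀ s, euclNorm (A *ᵥ x s) ≤ R) → (∀ s, euclNorm (y s) ≤ R) →
      (∀ k : Fin L,
        Integrable (fun W => gradNorm act A B x y W k) (initLaw P L d) ∧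
        ∫ W, gradNorm act A B x y W k ∂(initLaw P L d) ≤
          C * √(act.widthFactor d) *
            (lam act d σ ^ (((L : ℝ) - 1) / 2) + lam act d σ ^ ((2 * (L : ℝ) - 1) / 2)) ∧
        (0 < lam act d σ → lam act d σ ≤ 1 →
          ∫ W, gradNorm act A B x y W k ∂(initLaw P L d) ≤
            C * √(act.widthFactor d / lam act d σ) * lam act d σ ^ ((L : ℝ) / 2))) ∧
      (∀ k : Fin L,
        Integrable (fun W => hessNorm act A B x y W k k) (initLaw P L d) ∧
        ∫ W, hessNorm act A B x y W k k ∂(initLaw P L d) ≤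
          C * act.widthFactor d * lam act d σ ^ ((L : ℝ) - 1) ∧
        (0 < lam act d σ →
          ∫ W, hessNorm act A B x y W k k ∂(initLaw P L d) ≤
            C * (act.widthFactor d / lam act d σ) * lam act d σ ^ (L : ℝ))) ∧
      (∀ k ℓ : Fin L, k ≠ ℓ →
        Integrable (fun W => hessNorm act A B x y W k ℓ) (initLaw P L d) ∧
        ∫ W, hessNorm act A B x y W k ℓ ∂(initLaw P L d) ≤
          C * √(d * act.widthFactor d) *
            (lam act d σ ^ (((L : ℝ) - 2) / 2) + lam act d σ ^ ((L : ℝ) - 1)) ∧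
        (0 < lam act d σ → lam act d σ ≤ 1 →
          ∫ W, hessNorm act A B x y W k ℓ ∂(initLaw P L d) ≤
            C * (√(d * act.widthFactor d) / lam act d σ) * lam act d σ ^ ((L : ℝ) / 2)))) ∧
    (∀ dOut : ℕ, ∃ C : ℝ, ∀ (n dIn d L : ℕ) (P : Measure ℝ) (σ : ℝ)
        (x : Fin n → Fin dIn → ℝ) (y : Fin n → Fin dOut → ℝ),
      act.IsAdmissibleLaw P σ → (∀ s, euclNorm (x s) ≤ R) → (∀ s, euclNorm (y s) ≤ R) →
      (∀ k : Fin L,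
        Integrable (fun θ => gradNorm act (Matrix.of θ.1) (Matrix.of θ.2.1) x y θ.2.2 k)
          (jointLaw P dIn dOut d L) ∧
        ∫ θ, gradNorm act (Matrix.of θ.1) (Matrix.of θ.2.1) x y θ.2.2 k
            ∂(jointLaw P dIn dOut d L) ≤
          C * (lam act d σ ^ (((L : ℝ) + 1) / 2) + lam act d σ ^ ((2 * (L : ℝ) + 3) / 2)) ∧
        (lam act d σ ≤ 1 →
          ∫ θ, gradNorm act (Matrix.of θ.1) (Matrix.of θ.2.1) x y θ.2.2 k
              ∂(jointLaw P dIn dOut d L) ≤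
            C * lam act d σ ^ ((L : ℝ) / 2))) ∧
      (∀ k : Fin L,
        Integrable (fun θ => hessNorm act (Matrix.of θ.1) (Matrix.of θ.2.1) x y θ.2.2 k k)
          (jointLaw P dIn dOut d L) ∧
        ∫ θ, hessNorm act (Matrix.of θ.1) (Matrix.of θ.2.1) x y θ.2.2 k k
            ∂(jointLaw P dIn dOut d L) ≤
          C * lam act d σ ^ ((L : ℝ) + 1) ∧
        (lam act d σ ≤ 1 →
          ∫ θ, hessNorm act (Matrix.of θ.1) (Matrix.of θ.2.1) x y θ.2.2 k k
              ∂(jointLaw P dIn dOut d L) ≤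
            C * lam act d σ ^ (L : ℝ))) ∧
      (∀ k ℓ : Fin L, k ≠ ℓ →
        Integrable (fun θ => hessNorm act (Matrix.of θ.1) (Matrix.of θ.2.1) x y θ.2.2 k ℓ)
          (jointLaw P dIn dOut d L) ∧
        ∫ θ, hessNorm act (Matrix.of θ.1) (Matrix.of θ.2.1) x y θ.2.2 k ℓ
            ∂(jointLaw P dIn dOut d L) ≤
          C * (√d * lam act d σ ^ ((L : ℝ) / 2) + lam act d σ ^ ((L : ℝ) + 1)) ∧
        (lam act d σ ≤ 1 →
          ∫ θ, hessNorm act (Matrix.of θ.1) (Matrix.of θ.2.1) x y θ.2.2 k ℓ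
              ∂(jointLaw P dIn dOut d L) ≤
            C * √d * lam act d σ ^ ((L : ℝ) / 2)))) ∧
    (∀ (n dIn dOut d L : ℕ) (P : Measure ℝ)
        (A : Matrix (Fin d) (Fin dIn) ℝ) (B : Matrix (Fin dOut) (Fin d) ℝ)
        (x : Fin n → Fin dIn → ℝ) (y : Fin n → Fin dOut → ℝ),
      IsProbabilityMeasure P → (act = Activation.linear ∨ ∀ t : ℝ, P {t} = 0) →
      ∀ᵐ W ∂(initLaw P L d),
        ContDiffAt ℝ (⊤ : ℕ∞) (loss act A B x y) W ∧
        (∀ k, gradBlock (loss act A B x y) W k = gradBlock (gatedLoss act A B x y W) W k) ∧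
        (∀ k ℓ, hessBlock (loss act A B x y) W k ℓ =
          hessBlock (gatedLoss act A B x y W) W k ℓ)) := by
  refine ⟨⟨momentConst (R ^ 2) R, ?_⟩, fun dOut => ⟨momentConst (2 * √dOut * |R|) |R|, ?_⟩, ?_⟩
  · intro n dIn dOut d L P σ A B x y hP hB hx hy
    exact ⟨integral_gradNorm_initLaw_le hP hB hx hy, integral_hessNorm_self_initLaw_le hP hB hx,
      fun _ _ => integral_hessNorm_initLaw_le hP hB hx hy⟩
  · intro n dIn d L P σ x y hP hx hy
    have hx' (s : Fin n) : euclNorm (x s) ≤ |R| := (hx s).trans (le_abs_self R)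
    have hy' (s : Fin n) : euclNorm (y s) ≤ |R| := (hy s).trans (le_abs_self R)
    exact ⟨integral_gradNorm_jointLaw_le hP (abs_nonneg R) hx' hy',
      integral_hessNorm_self_jointLaw_le hP (abs_nonneg R) hx',
      fun _ _ => integral_hessNorm_jointLaw_le hP (abs_nonneg R) hx' hy'⟩
  · intro n dIn dOut d L P A B x y _ hact
    filter_upwards [ae_loss_eventuallyEq_gatedLoss act hact A B x y] with W hW
    exact ⟨(contDiff_gatedLoss act A B x y W).contDiffAt.congr_of_eventuallyEq hW,
      gradBlock_congr hW, hessBlock_congr hW⟩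

theorem theorem3 (act : Activation) (R : ℝ) :
    -- fixed input and output matrices
    (∃ C : ℝ, ∀ (n dIn dOut d L : ℕ) (P : Measure ℝ) (σ : ℝ)
        (A : Matrix (Fin d) (Fin dIn) ℝ) (B : Matrix (Fin dOut) (Fin d) ℝ)
        (x : Fin n → Fin dIn → ℝ) (y : Fin n → Fin dOut → ℝ),
      IsInitLaw P σ → frobNorm B ≤ R →
      (∀ s, euclNorm (A *ᵥ x s) ≤ R) → (∀ s, euclNorm (y s) ≤ R) →
      (∀ k : Fin L,
        Integrable (fun W => gradNorm act A B x y W k) (initLaw P L d) ∧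
        ∫ W, gradNorm act A B x y W k ∂(initLaw P L d) ≤
          C * √(act.widthFactor d) *
            (lam act d σ ^ (((L : ℝ) - 1) / 2) + lam act d σ ^ ((2 * (L : ℝ) - 1) / 2)) ∧
        (0 < lam act d σ → lam act d σ ≤ 1 →
          ∫ W, gradNorm act A B x y W k ∂(initLaw P L d) ≤
            C * √(act.widthFactor d / lam act d σ) * lam act d σ ^ ((L : ℝ) / 2))) ∧
      (∀ k : Fin L,
        Integrable (fun W => hessNorm act A B x y W k k) (initLaw P L d) ∧
        ∫ W, hessNorm act A B x y W k k ∂(initLaw P L d) ≤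
          C * act.widthFactor d * lam act d σ ^ ((L : ℝ) - 1) ∧
        (0 < lam act d σ →
          ∫ W, hessNorm act A B x y W k k ∂(initLaw P L d) ≤
            C * (act.widthFactor d / lam act d σ) * lam act d σ ^ (L : ℝ))) ∧
      (∀ k ℓ : Fin L, k ≠ ℓ →
        Integrable (fun W => hessNorm act A B x y W k ℓ) (initLaw P L d) ∧
        ∫ W, hessNorm act A B x y W k ℓ ∂(initLaw P L d) ≤
          C * √(d * act.widthFactor d) *
            (lam act d σ ^ (((L : ℝ) - 2) / 2) + lam act d σ ^ ((L : ℝ) - 1)) ∧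
        (0 < lam act d σ → lam act d σ ≤ 1 →
          ∫ W, hessNorm act A B x y W k ℓ ∂(initLaw P L d) ≤
            C * (√(d * act.widthFactor d) / lam act d σ) * lam act d σ ^ ((L : ℝ) / 2)))) ∧
    -- input and output matrices with i.i.d. entries of the same law
    (∀ dOut : ℕ, ∃ C : ℝ, ∀ (n dIn d L : ℕ) (P : Measure ℝ) (σ : ℝ)
        (x : Fin n → Fin dIn → ℝ) (y : Fin n → Fin dOut → ℝ),
      IsInitLaw P σ → (∀ s, euclNorm (x s) ≤ R) → (∀ s, euclNorm (y s) ≤ R) →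
      (∀ k : Fin L,
        Integrable (fun θ => gradNorm act (Matrix.of θ.1) (Matrix.of θ.2.1) x y θ.2.2 k)
          (jointLaw P dIn dOut d L) ∧
        ∫ θ, gradNorm act (Matrix.of θ.1) (Matrix.of θ.2.1) x y θ.2.2 k
            ∂(jointLaw P dIn dOut d L) ≤
          C * (lam act d σ ^ (((L : ℝ) + 1) / 2) + lam act d σ ^ ((2 * (L : ℝ) + 3) / 2)) ∧
        (lam act d σ ≤ 1 →
          ∫ θ, gradNorm act (Matrix.of θ.1) (Matrix.of θ.2.1) x y θ.2.2 k
              ∂(jointLaw P dIn dOut d L) ≤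
            C * lam act d σ ^ ((L : ℝ) / 2))) ∧
      (∀ k : Fin L,
        Integrable (fun θ => hessNorm act (Matrix.of θ.1) (Matrix.of θ.2.1) x y θ.2.2 k k)
          (jointLaw P dIn dOut d L) ∧
        ∫ θ, hessNorm act (Matrix.of θ.1) (Matrix.of θ.2.1) x y θ.2.2 k k
            ∂(jointLaw P dIn dOut d L) ≤
          C * lam act d σ ^ ((L : ℝ) + 1) ∧
        (lam act d σ ≤ 1 →
          ∫ θ, hessNorm act (Matrix.of θ.1) (Matrix.of θ.2.1) x y θ.2.2 k k
              ∂(jointLaw P dIn dOut d L) ≤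
            C * lam act d σ ^ (L : ℝ))) ∧
      (∀ k ℓ : Fin L, k ≠ ℓ →
        Integrable (fun θ => hessNorm act (Matrix.of θ.1) (Matrix.of θ.2.1) x y θ.2.2 k ℓ)
          (jointLaw P dIn dOut d L) ∧
        ∫ θ, hessNorm act (Matrix.of θ.1) (Matrix.of θ.2.1) x y θ.2.2 k ℓ
            ∂(jointLaw P dIn dOut d L) ≤
          C * (√d * lam act d σ ^ ((L : ℝ) / 2) + lam act d σ ^ ((L : ℝ) + 1)) ∧
        (lam act d σ ≤ 1 →
          ∫ θ, hessNorm act (Matrix.of θ.1) (Matrix.of θ.2.1) x y θ.2.2 k ℓ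
              ∂(jointLaw P dIn dOut d L) ≤
            C * √d * lam act d σ ^ ((L : ℝ) / 2)))) ∧
    -- the derivatives above are those of the loss
    (∀ (n dIn dOut d L : ℕ) (P : Measure ℝ) (σ : ℝ)
        (A : Matrix (Fin d) (Fin dIn) ℝ) (B : Matrix (Fin dOut) (Fin d) ℝ)
        (x : Fin n → Fin dIn → ℝ) (y : Fin n → Fin dOut → ℝ),
      IsInitLaw P σ → (act = Activation.linear ∨ ∀ t : ℝ, P {t} = 0) →
      ∀ᵐ W ∂(initLaw P L d),
        ContDiffAt ℝ (⊤ : ℕ∞) (loss act A B x y) W ∧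
        (∀ k, gradBlock (loss act A B x y) W k = gradBlock (gatedLoss act A B x y W) W k) ∧
        (∀ k ℓ, hessBlock (loss act A B x y) W k ℓ =
          hessBlock (gatedLoss act A B x y W) W k ℓ)) := by
  obtain ⟨⟨C, hfixed⟩, hrandom, hderiv⟩ := theorem3_general act R
  refine ⟨⟨C, ?_⟩, fun dOut => ?_, ?_⟩
  · intro n dIn dOut d L P σ A B x y hP
    exact hfixed n dIn dOut d L P σ A B x y hP.isAdmissibleLaw
  · obtain ⟨C, hC⟩ := hrandom dOut
    exact ⟨C, fun n dIn d L P σ x y hP => hC n dIn d L P σ x y hP.isAdmissibleLaw⟩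
  · intro n dIn dOut d L P σ A B x y hP
    exact hderiv n dIn dOut d L P A B x y hP.isProbabilityMeasure
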